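/- Let $(w_n)_{n\ge 1}$ be non-negative real numbers with $w_1>0$, and put $W_n=\sum_{i=1}^n w_i$ and $a_n=\sum_{i=1}^n w_i/W_i$. Let $(T_n)_{n\ge1}$ be the weighted recursive tree with weights $(w_n)_{n\ge1}$: $T_1$ consists of the root, labelled $1$, and $T_{n+1}$ is obtained from $T_n$ by adding a vertex labelled $n+1$ whose parent is, conditionally on $T_n$, the vertex labelled $k$ with probability $w_k/W_n$, for $k=1,\dots,n$. Let $H(T_n)$ be the height of $T_n$, that is, the largest graph distance of a vertex of $T_n$ from the root. Let $\alpha>1$, $\beta>0$ and let $J:[1,\infty)\to(0,\infty)$. If $\beta<\frac12$, assume that $J$ is twice differentiable with $x^iJ^{(i)}(x)/J(x)\to0$ as $x\to\infty$ for $i=1,2$; if $\beta\ge\frac12$, assume that $J$ is measurable with $J(\lambda x)/J(x)\to1$ as $x\to\infty$ for every $\lambda>0$. Assume that $a_n$ converges to a finite limit $a_\infty$ and that, as $n\to\infty$, $$a_\infty-a_n=\exp\bigl(-(\alpha-1)(\log n)^\beta\bigr)\cdot J\bigl(\exp((\log n)^\beta)\bigr)\cdot\Bigl(1+o\bigl((\log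 n)^{\min(4\beta-2,\,0)}\bigr)\Bigr).$$ Then the following hold, where $x_n\sim y_n$ means $x_n=y_n(1+o(1))$. 1. If $\beta\in(0,1)$ and $\sum_{i\ge n}w_i^2/W_i^2=O(1/n)$, then almost surely, as $n\to\infty$, $$H(T_n)\sim\frac{(\log n)^{1-\beta}}{(\alpha-1)(1-\beta)}.$$ 2. If $\beta=1$ and, for every $\varepsilon>0$, $\sum_{i\ge n}w_i^2/W_i^2=O\bigl(n^{-(2\alpha-1-\varepsilon)}\bigr)$, then almost surely, as $n\to\infty$, $$H(T_n)\sim\frac{\log\log n}{\log\alpha}.$$ 3. If $\beta>1$ and, for some $\varepsilon>0$, $\sum_{i\ge n}w_i^2/W_i^2=O\bigl(n^{-\varepsilon}\exp(-2(\alpha-1)(\log n)^\beta)\,J(\exp((\log n)^\beta))^2\bigr)$, then almost surely, as $n\to\infty$, $$H(T_n)\sim\frac{\log\log\log n}{\log\beta}.$$ -/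

import Mathlib

open Filter Topology MeasureTheory ProbabilityTheory Asymptotics

noncomputable section

/-- A growing sequence of rooted trees `T 1 ⊂ T 2 ⊂ ⋯`. The tree `T n` has the vertices with labels
`1, …, n` and the root `1`; `T (n + 1)` is obtained from `T n` by attaching the vertex `n + 1` to
the vertex `parent (n + 1)` of `T n`. (The values `parent 0` and `parent 1` have no meaning and are
never used.) -/
structure GrowingTree where
  parent : ℕ → ℕ
  parent_mem : ∀ n, 1 ≤ n → parent (n + 1) ∈ Finset.Icc 1 n

namespace GrowingTree

/-- The height of the vertex with label `v`: the number of edges between it and the root `1`. -/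
def depth (T : GrowingTree) : ℕ → ℕ
  | 0 => 0
  | 1 => 0
  | v + 2 => depth T (T.parent (v + 2)) + 1
termination_by v => v
decreasing_by
  have h := Finset.mem_Icc.1 (T.parent_mem (v + 1) (by omega))
  have h2 : T.parent (v + 2) ≤ v + 1 := h.2
  omega

/-- The height of the tree `T n`: the largest height of a vertex with label in `1, …, n`. -/
def height (T : GrowingTree) (n : ℕ) : ℕ := (Finset.Icc 1 n).sup T.depth

/-- The tree `T n`, encoded by the parents of its vertices `2, …, n`. -/
def upTo (T : GrowingTree) (n : ℕ) : Finset.Icc 2 n → ℕ := fun i => T.parent i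

end GrowingTree

namespace WRT

/-- `W n = w 1 + ⋯ + w n`. -/
def W (w : ℕ → ℝ) (n : ℕ) : ℝ := ∑ i ∈ Finset.Icc 1 n, w i

/-- `a n = w 1 / W 1 + ⋯ + w n / W n`. -/
def a (w : ℕ → ℝ) (n : ℕ) : ℝ := ∑ i ∈ Finset.Icc 1 n, w i / W w i

/-- The tail `∑_{i ≥ n} w i ^ 2 / W i ^ 2`. The series converges as soon as `a w` does, because
`0 ≤ w i / W i ≤ 1`. -/
def sqTail (w : ℕ → ℝ) (n : ℕ) : ℝ := ∑' j : ℕ, w (n + j) ^ 2 / W w (n + j) ^ 2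

/-- The random sequence of growing trees `T` is a weighted recursive tree with weights
`w 1, w 2, …`: conditionally on `T n`, the parent of the vertex `n + 1` is the vertex `k` with
probability `w k / W n`, for `k = 1, …, n`. -/
structure IsWRT {Ω : Type*} [MeasurableSpace Ω] (μ : Measure Ω) (w : ℕ → ℝ)
    (T : Ω → GrowingTree) : Prop where
  measurable_upTo : ∀ n, Measurable fun ω => (T ω).upTo n
  condProb_parent : ∀ n, 1 ≤ n → ∀ k ∈ Finset.Icc 1 n,
    μ⟦{ω | (T ω).parent (n + 1) = k} | MeasurableSpace.comap (fun ω => (T ω).upTo n) inferInstance⟧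
      =ᵐ[μ] fun _ => w k / W w n

/-- `L`, viewed as a function on `[1, ∞)`, is slowly varying. -/
structure SlowlyVarying (L : ℝ → ℝ) : Prop where
  measurable : Measurable fun x : Set.Ici (1 : ℝ) => L x
  tendsto : ∀ c : ℝ, 0 < c → Tendsto (fun x => L (c * x) / L x) atTop (𝓝 1)

/-- `L`, viewed as a function on `[1, ∞)`, is `k` times differentiable (one-sidedly at `1`), and
`x ^ i * L⁽ⁱ⁾ x / L x → 0` as `x → ∞` for `1 ≤ i ≤ k`. -/
structure SmoothlySlowlyVarying (k : ℕ) (L : ℝ → ℝ) : Prop where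
  differentiableOn : ∀ i, i < k →
    DifferentiableOn ℝ (iteratedDerivWithin i L (Set.Ici 1)) (Set.Ici 1)
  tendsto : ∀ i, 1 ≤ i → i ≤ k →
    Tendsto (fun x => x ^ i * iteratedDerivWithin i L (Set.Ici 1) x / L x) atTop (𝓝 0)

/-- `exp (-(α - 1) log^β n) * J (exp (log^β n))`. -/
def mainTerm (α β : ℝ) (J : ℝ → ℝ) (n : ℕ) : ℝ :=
  Real.exp (-(α - 1) * Real.log n ^ β) * J (Real.exp (Real.log n ^ β))

/-- `a n` converges to some finite limit `a_∞` and
`a_∞ - a n = exp (-(α - 1) log^β n) * J (exp (log^β n)) * (1 + o ((log n) ^ min (4β - 2) 0))`. -/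
def QuicklyConverging (w : ℕ → ℝ) (α β : ℝ) (J : ℝ → ℝ) : Prop :=
  ∃ aInf : ℝ, Tendsto (a w) atTop (𝓝 aInf) ∧
    ∃ r : ℕ → ℝ, r =o[atTop] (fun n : ℕ => Real.log n ^ min (4 * β - 2) 0) ∧
      ∀ n, 1 ≤ n → aInf - a w n = mainTerm α β J n * (1 + r n)

end WRT

end

/-! ### Depths, heights and level weights of a fixed growing tree. -/

namespace GrowingTree

/-! Both bounds follow one recursion on the logarithmic scale. Write `aInf` for the limit of `a n`;
then `aInf - a n` is roughly `exp (-(α - 1) (log n) ^ β)`.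

Upper bound. Suppose that a given vertex has height at least `i` with probability at most `exp
(-L)`. A union bound shows that hardly any vertex with label below `exp ((1 - ε) L)` is that high.
So a vertex of height `i + 1` needs a parent with a larger label, and since `w k / W n ≤ w k / W k`
this costs a further factor `aInf - a (exp ((1 - ε) L))`. Hence `L` moves to about `L + (α - 1) L ^
β` per generation (`measureReal_comp_parent_le`, `measure_exists_depth_le`, `ae_height_le`).

Lower bound. Suppose that at time `exp (κ L)` the vertices of height at least `j` carry a fraction
at least `exp (-L)` of the weight. Each later vertex attaches to them with at least this
probability, so a window of later vertices puts at height `j + 1` or more about `exp (-L)` times its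
own total weight. A window of logarithmic length of order `L ^ β` has weight at least of order
`(aInf - a n) / log n` (`window_mass`), and again `L` moves to about `L + (α - 1) (κ L) ^ β`. A
Chernoff bound makes the failure probabilities summable; the condition on `∑ w i ^ 2 / W i ^ 2` is
what keeps the variance small enough (`measure_not_forall_le_height`, `ae_le_height`).

The height at time `n` is thus the number of steps of `L ↦ L + (α - 1) L ^ β` needed to reach `log
n`. A function `Ψ` growing by about one per step counts them (`IsHeightScale`): a power of `L` if `β
< 1`, a logarithm if `β = 1`, an iterated logarithm if `β > 1`. Starting the recursion at a large
`l` makes the total failure probability small, and letting `l` tend to infinity gives almost sure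
statements. -/

lemma depth_zero (T : GrowingTree) : T.depth 0 = 0 := by
  rw [depth]

lemma depth_one (T : GrowingTree) : T.depth 1 = 0 := by
  rw [depth]

lemma depth_succ (T : GrowingTree) {n : ℕ} (hn : 1 ≤ n) :
    T.depth (n + 1) = T.depth (T.parent (n + 1)) + 1 := by
  obtain ⟨m, rfl⟩ := Nat.exists_eq_add_of_le' hn
  rw [depth]

lemma one_le_parent (T : GrowingTree) {n : ℕ} (hn : 1 ≤ n) : 1 ≤ T.parent (n + 1) :=
  (Finset.mem_Icc.1 (T.parent_mem n hn)).1

lemma parent_le (T : GrowingTree) {n : ℕ} (hn : 1 ≤ n) : T.parent (n + 1) ≤ n :=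
  (Finset.mem_Icc.1 (T.parent_mem n hn)).2

/-- Labels strictly increase along every path from the root, so a vertex of large depth has a large
label. -/
lemma depth_lt (T : GrowingTree) : ∀ n : ℕ, 1 ≤ n → T.depth n < n := by
  intro n
  induction n using Nat.strong_induction_on with
  | _ n ih =>
    intro hn
    rcases Nat.lt_or_ge n 2 with h | h
    · obtain rfl : n = 1 := by omega
      simp [depth_one]
    · obtain ⟨m, rfl⟩ := Nat.exists_eq_add_of_le' hn
      have hm : 1 ≤ m := by omega
      rw [T.depth_succ hm]
      have h1 := T.parent_le hm
      have := ih (T.parent (m + 1)) (by omega) (T.one_le_parent hm)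
      omega

lemma parent_eq_of_upTo_eq {T T' : GrowingTree} {n i : ℕ} (h : T.upTo n = T'.upTo n)
    (h2 : 2 ≤ i) (hi : i ≤ n) : T.parent i = T'.parent i :=
  congrFun h ⟨i, Finset.mem_Icc.2 ⟨h2, hi⟩⟩

lemma depth_eq_of_upTo_eq {T T' : GrowingTree} {n : ℕ} (h : T.upTo n = T'.upTo n) :
    ∀ v ≤ n, T.depth v = T'.depth v := by
  intro v
  induction v using Nat.strong_induction_on with
  | _ v ih =>
    intro hv
    match v with
    | 0 => simp [depth_zero]
    | 1 => simp [depth_one]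
    | v + 2 =>
      rw [T.depth_succ (by omega), T'.depth_succ (by omega),
        ← parent_eq_of_upTo_eq h (by omega) hv]
      have h1 := T.parent_le (n := v + 1) (by omega)
      rw [ih _ (by omega) (by omega)]

lemma height_le_iff (T : GrowingTree) {n h : ℕ} :
    T.height n ≤ h ↔ ∀ v, 1 ≤ v → v ≤ n → T.depth v ≤ h := by
  simp [height, Finset.sup_le_iff]

lemma depth_le_height (T : GrowingTree) {n v : ℕ} (h1 : 1 ≤ v) (hv : v ≤ n) :
    T.depth v ≤ T.height n :=
  Finset.le_sup (f := T.depth) (Finset.mem_Icc.2 ⟨h1, hv⟩)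

lemma height_mono (T : GrowingTree) {m n : ℕ} (h : m ≤ n) : T.height m ≤ T.height n :=
  T.height_le_iff.2 fun _ h1 h2 => T.depth_le_height h1 (h2.trans h)

/-- The total weight of the vertices of `T n` whose height is at least `j`. -/
noncomputable def levelWeight (T : GrowingTree) (w : ℕ → ℝ) (j n : ℕ) : ℝ :=
  ∑ k ∈ Finset.Icc 1 n, if j ≤ T.depth k then w k else 0

/-- The total weight of the vertices of `T m` outside `T n` whose height is at least `j`. -/
noncomputable def levelIncrement (T : GrowingTree) (w : ℕ → ℝ) (j n m : ℕ) : ℝ :=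
  ∑ k ∈ Finset.Ioc n m, if j ≤ T.depth k then w k else 0

lemma levelWeight_mono (T : GrowingTree) {w : ℕ → ℝ} (hw : ∀ n, 1 ≤ n → 0 ≤ w n) (j : ℕ) {m n : ℕ}
    (h : m ≤ n) : T.levelWeight w j m ≤ T.levelWeight w j n := by
  apply Finset.sum_le_sum_of_subset_of_nonneg (Finset.Icc_subset_Icc_right h)
  intro i hi _
  have := hw i (Finset.mem_Icc.1 hi).1
  split_ifs <;> simp [this]

lemma levelIncrement_le_levelWeight (T : GrowingTree) {w : ℕ → ℝ} (hw : ∀ n, 1 ≤ n → 0 ≤ w n)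
    (j n m : ℕ) : T.levelIncrement w j n m ≤ T.levelWeight w j m := by
  apply Finset.sum_le_sum_of_subset_of_nonneg
  · intro i hi
    simp only [Finset.mem_Ioc, Finset.mem_Icc] at hi ⊢
    omega
  intro i hi _
  have := hw i (Finset.mem_Icc.1 hi).1
  split_ifs <;> simp [this]

lemma levelWeight_zero (T : GrowingTree) (w : ℕ → ℝ) (n : ℕ) :
    T.levelWeight w 0 n = WRT.W w n := by
  simp [levelWeight, WRT.W]

lemma le_height_of_levelWeight_pos (T : GrowingTree) {w : ℕ → ℝ} {j n : ℕ}
    (h : 0 < T.levelWeight w j n) : j ≤ T.height n := by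
  by_contra hlt
  have : T.levelWeight w j n = 0 := by
    apply Finset.sum_eq_zero
    intro k hk
    rw [Finset.mem_Icc] at hk
    have := T.depth_le_height hk.1 hk.2
    rw [if_neg (by omega)]
  linarith

end GrowingTree

namespace WRT

/-! ### Deterministic estimates on the weights. -/

section Weights

variable {w : ℕ → ℝ}

lemma W_succ (w : ℕ → ℝ) (n : ℕ) : W w (n + 1) = W w n + w (n + 1) := by
  simp [W, Finset.sum_Icc_succ_top]

lemma a_succ (w : ℕ → ℝ) (n : ℕ) : a w (n + 1) = a w n + w (n + 1) / W w (n + 1) := by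
  simp [a, Finset.sum_Icc_succ_top]

lemma W_mono (hw : ∀ n, 1 ≤ n → 0 ≤ w n) : Monotone (W w) :=
  monotone_nat_of_le_succ fun n => by
    rw [W_succ]; linarith [hw (n + 1) (by omega)]

lemma W_one (w : ℕ → ℝ) : W w 1 = w 1 := by simp [W]

lemma W_pos (hw : ∀ n, 1 ≤ n → 0 ≤ w n) (hw1 : 0 < w 1) {n : ℕ} (hn : 1 ≤ n) : 0 < W w n :=
  (W_one w ▸ hw1 : 0 < W w 1).trans_le (W_mono hw hn)

lemma a_mono (hw : ∀ n, 1 ≤ n → 0 ≤ w n) (hw1 : 0 < w 1) : Monotone (a w) :=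
  monotone_nat_of_le_succ fun n => by
    rw [a_succ]
    have := div_nonneg (hw (n + 1) (by omega)) (W_pos hw hw1 (n := n + 1) (by omega)).le
    linarith

lemma a_sub_a (w : ℕ → ℝ) {n m : ℕ} (h : n ≤ m) :
    a w m - a w n = ∑ i ∈ Finset.Ioc n m, w i / W w i := by
  induction m, h using Nat.le_induction with
  | base => simp
  | succ m hm ih => rw [Finset.sum_Ioc_succ_top (by omega), ← ih, a_succ]; ring

lemma W_sub_W (w : ℕ → ℝ) {n m : ℕ} (h : n ≤ m) :
    W w m - W w n = ∑ i ∈ Finset.Ioc n m, w i := by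
  induction m, h using Nat.le_induction with
  | base => simp
  | succ m hm ih => rw [Finset.sum_Ioc_succ_top (by omega), ← ih, W_succ]; ring

/-- If `a` converges, then the total weight is bounded. -/
lemma exists_W_le (hw : ∀ n, 1 ≤ n → 0 ≤ w n) (hw1 : 0 < w 1) {aInf : ℝ}
    (ha : Tendsto (a w) atTop (𝓝 aInf)) : ∃ K, 0 < K ∧ ∀ n, W w n ≤ K := by
  have hev : ∀ᶠ n in atTop, aInf - 1 / 2 < a w n := ha.eventually_const_lt (by linarith)
  obtain ⟨n, hn, hn1⟩ := (hev.and (eventually_ge_atTop 1)).exists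
  have hWn := W_pos hw hw1 hn1
  -- For `m ≥ n`, `(W m - W n) / W m ≤ a m - a n ≤ 1 / 2`, whence `W m ≤ 2 * W n`.
  refine ⟨2 * W w n, by positivity, fun m => ?_⟩
  rcases le_total m n with h | h
  · linarith [W_mono hw h]
  have hm := W_pos hw hw1 (hn1.trans h)
  have h1 : (W w m - W w n) / W w m ≤ a w m - a w n := by
    rw [W_sub_W w h, a_sub_a w h, Finset.sum_div]
    refine Finset.sum_le_sum fun i hi => ?_
    rw [Finset.mem_Ioc] at hi
    exact div_le_div_of_nonneg_left (hw i (by omega)) (W_pos hw hw1 (by omega))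
      (W_mono hw hi.2)
  have h2 : a w m ≤ aInf := (a_mono hw hw1).ge_of_tendsto ha m
  rw [div_le_iff₀ hm] at h1
  nlinarith

/-- Over a window, the weights sum up to at least `w 1` times the increment of `a`. -/
lemma mul_a_sub_a_le (hw : ∀ n, 1 ≤ n → 0 ≤ w n) (hw1 : 0 < w 1) {n m : ℕ} (h : n ≤ m) :
    w 1 * (a w m - a w n) ≤ ∑ i ∈ Finset.Ioc n m, w i := by
  rw [a_sub_a w h, Finset.mul_sum]
  refine Finset.sum_le_sum fun i hi => ?_
  rw [Finset.mem_Ioc] at hi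
  have hi1 : 1 ≤ i := by omega
  have hWi := W_pos hw hw1 hi1
  rw [mul_div_assoc', div_le_iff₀ hWi, mul_comm]
  exact mul_le_mul_of_nonneg_left (W_one w ▸ W_mono hw hi1) (hw i hi1)

lemma summable_sq (hw : ∀ n, 1 ≤ n → 0 ≤ w n) (hw1 : 0 < w 1) {aInf : ℝ}
    (ha : Tendsto (a w) atTop (𝓝 aInf)) {n : ℕ} (hn : 1 ≤ n) :
    Summable fun j : ℕ => w (n + j) ^ 2 / W w (n + j) ^ 2 := by
  have hnonneg : ∀ i, 1 ≤ i → 0 ≤ w i / W w i := fun i hi =>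
    div_nonneg (hw i hi) (W_pos hw hw1 hi).le
  have hle : ∀ i, 1 ≤ i → w i / W w i ≤ 1 := fun i hi => by
    rw [div_le_one (W_pos hw hw1 hi)]
    exact Finset.single_le_sum (f := w) (fun k hk => hw k (Finset.mem_Icc.1 hk).1)
      (Finset.mem_Icc.2 ⟨hi, le_rfl⟩)
  -- Each ratio `w i / W i` is at most one, so its square is at most the increment of `a`; the index
  -- `n - 1` makes the term `i = n` the first increment.
  refine summable_of_sum_range_le (c := aInf - a w (n - 1))
    (fun j => by positivity) fun m => ?_
  have h2 : a w (n - 1 + m) ≤ aInf := (a_mono hw hw1).ge_of_tendsto ha _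
  refine le_trans ?_ (sub_le_sub_right h2 _)
  clear h2
  induction m with
  | zero => simp
  | succ m ih =>
    rw [Finset.sum_range_succ, ← add_assoc, a_succ, show n - 1 + m + 1 = n + m by omega]
    have h3 : w (n + m) ^ 2 / W w (n + m) ^ 2 ≤ w (n + m) / W w (n + m) := by
      rw [← div_pow, sq]
      exact mul_le_of_le_one_left (hnonneg _ (by omega)) (hle _ (by omega))
    linarith

lemma sum_sq_le (hw : ∀ n, 1 ≤ n → 0 ≤ w n) (hw1 : 0 < w 1) {aInf K : ℝ}
    (ha : Tendsto (a w) atTop (𝓝 aInf)) (hK : ∀ n, W w n ≤ K) {n m : ℕ} (hn : 1 ≤ n) :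
    ∑ i ∈ Finset.Ioc n m, w i ^ 2 ≤ K ^ 2 * sqTail w n := by
  have hs := summable_sq hw hw1 ha hn
  have h1 : ∑ i ∈ Finset.Ioc n m, w i ^ 2 / W w i ^ 2 ≤ sqTail w n := by
    have : ∑ i ∈ Finset.Ioc n m, w i ^ 2 / W w i ^ 2
        ≤ ∑ i ∈ Finset.Ico n (n + (m + 1)), w i ^ 2 / W w i ^ 2 := by
      apply Finset.sum_le_sum_of_subset_of_nonneg
      · intro i hi
        simp only [Finset.mem_Ioc, Finset.mem_Ico] at hi ⊢
        omega
      · intros; positivity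
    refine this.trans ?_
    rw [Finset.sum_Ico_eq_sum_range, Nat.add_sub_cancel_left]
    exact hs.sum_le_tsum _ fun i _ => by positivity
  refine le_trans ?_ (mul_le_mul_of_nonneg_left h1 (sq_nonneg K))
  rw [Finset.mul_sum]
  refine Finset.sum_le_sum fun i hi => ?_
  rw [Finset.mem_Ioc] at hi
  have hWi := W_pos hw hw1 (n := i) (by omega)
  rw [mul_div_assoc', le_div_iff₀ (by positivity), mul_comm]
  exact mul_le_mul_of_nonneg_right (pow_le_pow_left₀ hWi.le (hK i) 2) (sq_nonneg _)

end Weights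

/-! ### Quantities that depend only on the tree at a given time. -/

section Determined

variable {Ω : Type*} {T : Ω → GrowingTree}

/-- The σ-algebra generated by the tree `T n`. -/
abbrev treeSigma (T : Ω → GrowingTree) (n : ℕ) : MeasurableSpace Ω :=
  MeasurableSpace.comap (fun ω => (T ω).upTo n) inferInstance

/-- `g` depends on `ω` only through the tree `T n`. -/
def Determined {γ : Type*} (T : Ω → GrowingTree) (n : ℕ) (g : Ω → γ) : Prop :=
  Function.FactorsThrough g fun ω => (T ω).upTo n

lemma upTo_eq_of_le {T T' : GrowingTree} {m n : ℕ} (h : m ≤ n) (he : T.upTo n = T'.upTo n) :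
    T.upTo m = T'.upTo m := by
  funext i
  have := Finset.mem_Icc.1 i.2
  exact GrowingTree.parent_eq_of_upTo_eq he this.1 (this.2.trans h)

lemma Determined.mono {γ : Type*} {g : Ω → γ} {m n : ℕ} (h : m ≤ n) (hg : Determined T m g) :
    Determined T n g := fun _ _ he => hg (upTo_eq_of_le h he)

lemma determined_depth {v n : ℕ} (h : v ≤ n) : Determined T n fun ω => (T ω).depth v :=
  fun _ _ he => GrowingTree.depth_eq_of_upTo_eq he v h

/-- The space of possible trees at time `n` is countable, so all its subsets are measurable and
factoring through the tree is enough. -/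
lemma Determined.measurable_comap {γ : Type*} [MeasurableSpace γ] {g : Ω → γ} {n : ℕ}
    (hg : Determined T n g) :
    Measurable[treeSigma T n] g := by
  intro s _
  refine ⟨(fun ω => (T ω).upTo n) '' (g ⁻¹' s), Set.Countable.measurableSet (Set.to_countable _), ?_⟩
  ext ω
  constructor
  · rintro ⟨ω', h', he⟩
    have := hg he
    simpa [← this] using h'
  · exact fun h => ⟨ω, h, rfl⟩

variable [MeasurableSpace Ω] {μ : Measure Ω} {w : ℕ → ℝ}

lemma Determined.measurable (hT : IsWRT μ w T) {γ : Type*} [MeasurableSpace γ] {g : Ω → γ} {n : ℕ}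
    (hg : Determined T n g) : Measurable g :=
  hg.measurable_comap.mono (hT.measurable_upTo n).comap_le le_rfl

lemma Determined.measurableSet (hT : IsWRT μ w T) {n : ℕ} {p : Ω → Prop}
    (hp : Determined T n p) : MeasurableSet {ω | p ω} :=
  measurableSet_setOfPred.2 (hp.measurable hT)

lemma measurableSet_parent_eq (hT : IsWRT μ w T) {n : ℕ} (hn : 1 ≤ n) (k : ℕ) :
    MeasurableSet {ω | (T ω).parent (n + 1) = k} :=
  Determined.measurableSet hT (n := n + 1) fun ω ω' he => by
    simp only [GrowingTree.parent_eq_of_upTo_eq he (show 2 ≤ n + 1 by omega) le_rfl]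

lemma Determined.integrable [IsFiniteMeasure μ] (hT : IsWRT μ w T) {g : Ω → ℝ} {n : ℕ}
    (hg : Determined T n g) {C : ℝ} (hC : ∀ ω, |g ω| ≤ C) : Integrable g μ :=
  Integrable.of_bound (hg.measurable hT).aestronglyMeasurable C (ae_of_all _ hC)

end Determined

/-! ### Averaging over the parent of a new vertex. -/

section Law

variable {Ω : Type*} [MeasurableSpace Ω] {μ : Measure Ω} [IsProbabilityMeasure μ]
  {w : ℕ → ℝ} {T : Ω → GrowingTree}

/-- The conditional probability of the parent being `k` is constant, so the indicator decouples from
any bounded function of the tree at time `n` once that function is pulled out of the conditional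
expectation. -/
lemma integral_mul_indicator_parent (hT : IsWRT μ w T) {n k : ℕ} (hn : 1 ≤ n)
    (hk : k ∈ Finset.Icc 1 n) {g : Ω → ℝ} (hg : Determined T n g) {C : ℝ}
    (hC : ∀ ω, |g ω| ≤ C) :
    ∫ ω, g ω * {ω | (T ω).parent (n + 1) = k}.indicator (fun _ => (1 : ℝ)) ω ∂μ
      = w k / W w n * ∫ ω, g ω ∂μ := by
  have hle : treeSigma T n ≤ ‹MeasurableSpace Ω› := (hT.measurable_upTo n).comap_le
  set f := {ω | (T ω).parent (n + 1) = k}.indicator (fun _ => (1 : ℝ)) with hf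
  have hset := measurableSet_parent_eq hT hn k
  have hfi : Integrable f μ := (integrable_const 1).indicator hset
  have hgm : StronglyMeasurable[treeSigma T n] g := hg.measurable_comap.stronglyMeasurable
  have hgf : Integrable (g * f) μ := hfi.bdd_mul (hg.measurable hT).aestronglyMeasurable
    (ae_of_all _ hC)
  have h1 : ∫ ω, (g * f) ω ∂μ = ∫ ω, (μ[g * f|treeSigma T n]) ω ∂μ := (integral_condExp hle).symm
  have h2 : μ[g * f|treeSigma T n] =ᵐ[μ] g * μ[f|treeSigma T n] :=
    condExp_mul_of_stronglyMeasurable_left hgm hgf hfi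
  have h3 : μ[f|treeSigma T n] =ᵐ[μ] fun _ => w k / W w n := hT.condProb_parent n hn k hk
  change ∫ ω, (g * f) ω ∂μ = _
  rw [h1, ← integral_const_mul]
  apply integral_congr_ae
  filter_upwards [h2, h3] with ω h2 h3
  rw [h2, Pi.mul_apply, h3, mul_comm]

/-- Averaging over the parent of the vertex `n + 1`. -/
lemma integral_comp_parent (hT : IsWRT μ w T) {n : ℕ} (hn : 1 ≤ n) {Y : ℕ → Ω → ℝ}
    (hY : ∀ k ∈ Finset.Icc 1 n, Determined T n (Y k)) {C : ℝ} (hC : ∀ k ω, |Y k ω| ≤ C) :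
    ∫ ω, Y ((T ω).parent (n + 1)) ω ∂μ
      = ∑ k ∈ Finset.Icc 1 n, w k / W w n * ∫ ω, Y k ω ∂μ := by
  have h1 : ∀ ω, Y ((T ω).parent (n + 1)) ω = ∑ k ∈ Finset.Icc 1 n,
      Y k ω * {ω | (T ω).parent (n + 1) = k}.indicator (fun _ => (1 : ℝ)) ω := by
    intro ω
    rw [Finset.sum_eq_single ((T ω).parent (n + 1))]
    · simp
    · intro b _ hb
      simp [Set.indicator, hb.symm]
    · intro h
      exact absurd ((T ω).parent_mem n hn) h
  simp_rw [h1]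
  rw [integral_finsetSum]
  · exact Finset.sum_congr rfl fun k hk => integral_mul_indicator_parent hT hn hk (hY k hk) (hC k)
  · intro k hk
    exact ((integrable_const 1).indicator (measurableSet_parent_eq hT hn k)).bdd_mul
      ((hY k hk).measurable hT).aestronglyMeasurable (ae_of_all _ (hC k))

/-- If every `p k` has probability at most `Q` and `p k` is impossible for `k ≤ s`, then the parent
of `n + 1` satisfies `p` with probability at most `Q * (aInf - a s)`. -/
lemma measureReal_comp_parent_le (hT : IsWRT μ w T) (hw : ∀ n, 1 ≤ n → 0 ≤ w n) (hw1 : 0 < w 1)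
    {aInf : ℝ} (ha : Tendsto (a w) atTop (𝓝 aInf)) {n : ℕ} (hn : 1 ≤ n) {p : ℕ → Ω → Prop}
    (hp : ∀ k, 1 ≤ k → Determined T k (p k)) {s : ℕ} (hs : ∀ k ω, 1 ≤ k → p k ω → s < k) {Q : ℝ}
    (hQ0 : 0 ≤ Q) (hQ : ∀ k, 1 ≤ k → μ.real {ω | p k ω} ≤ Q) :
    μ.real {ω | p ((T ω).parent (n + 1)) ω} ≤ Q * (aInf - a w s) := by
  classical
  have hmeas : ∀ k, 1 ≤ k → MeasurableSet {ω | p k ω} := fun k hk => (hp k hk).measurableSet hT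
  have hdet : ∀ k ∈ Finset.Icc 1 n, Determined T n (fun ω => if p k ω then (1 : ℝ) else 0) := by
    intro k hk ω ω' he
    rw [Finset.mem_Icc] at hk
    simp only [(hp k hk.1).mono hk.2 he]
  have hmeas' : MeasurableSet {ω | p ((T ω).parent (n + 1)) ω} := by
    refine Determined.measurableSet hT (n := n + 1) fun ω ω' he => ?_
    have h1 : (T ω).parent (n + 1) = (T ω').parent (n + 1) :=
      GrowingTree.parent_eq_of_upTo_eq he (by omega) le_rfl
    change p ((T ω).parent (n + 1)) ω = p ((T ω').parent (n + 1)) ω'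
    rw [← h1]
    exact (hp _ ((T ω).one_le_parent hn)).mono (((T ω).parent_le hn).trans (Nat.le_succ n)) he
  have key := integral_comp_parent hT hn (Y := fun k ω => if p k ω then (1 : ℝ) else 0) hdet
    (C := 1) (by intro k ω; split_ifs <;> simp)
  have hint : ∀ q : Ω → Prop, MeasurableSet {ω | q ω} →
      ∫ ω, (if q ω then (1 : ℝ) else 0) ∂μ = μ.real {ω | q ω} := by
    intro q hq
    have : (fun ω => if q ω then (1 : ℝ) else 0) = {ω | q ω}.indicator 1 := by
      ext ω; simp [Set.indicator]
    rw [this, integral_indicator_one hq]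
  rw [hint _ hmeas'] at key
  rw [key]
  have hstep : ∀ k ∈ Finset.Icc 1 n,
      w k / W w n * ∫ ω, (if p k ω then (1 : ℝ) else 0) ∂μ ≤
        if s < k then Q * (w k / W w k) else 0 := by
    intro k hk
    rw [Finset.mem_Icc] at hk
    rw [hint _ (hmeas k hk.1)]
    split_ifs with h
    · rw [mul_comm]
      refine mul_le_mul (hQ k hk.1) ?_ (div_nonneg (hw k hk.1) (W_pos hw hw1 hn).le) hQ0
      -- Replacing `W n` by the smaller `W k` makes the bound uniform in `n`: the sum over `k > s`
      -- becomes a tail of `a`.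
      exact div_le_div_of_nonneg_left (hw k hk.1) (W_pos hw hw1 hk.1) (W_mono hw hk.2)
    · have : {ω | p k ω} = ∅ := by
        ext ω; simpa using fun hpk => h (hs k ω hk.1 hpk)
      simp [this]
  refine (Finset.sum_le_sum hstep).trans ?_
  rw [← Finset.sum_filter]
  have h2 : (Finset.Icc 1 n).filter (fun k => s < k) = Finset.Ioc s n := by
    ext k; simp only [Finset.mem_filter, Finset.mem_Icc, Finset.mem_Ioc]; omega
  have hle : ∀ m, a w m ≤ aInf := (a_mono hw hw1).ge_of_tendsto ha
  rw [h2, ← Finset.mul_sum]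
  refine mul_le_mul_of_nonneg_left ?_ hQ0
  rcases le_total s n with h | h
  · rw [← a_sub_a w h]; linarith [hle n]
  · rw [Finset.Ioc_eq_empty (by omega), Finset.sum_empty]; linarith [hle s]

end Law

end WRT

/-! ### Upper bound: chains of ancestors with large labels. -/

namespace GrowingTree

/-- The vertex `v` has at least `i` proper ancestors, its `(l + 1)`-th ancestor has a label larger
than `s (i - 1 - l)` for all `l < i`, and its `i`-th ancestor has height at least `h`. -/
def ConstrainedChain (T : GrowingTree) (h : ℕ) (s : ℕ → ℕ) : ℕ → ℕ → Prop
  | 0, v => h ≤ T.depth v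
  | i + 1, v => 2 ≤ v ∧ ConstrainedChain T h s i (T.parent v) ∧ s i < T.parent v

/-- The hypothesis excludes only vertices that end a constrained chain, yet it controls all high
vertices: by induction, the parent of a high vertex ends such a chain, hence has a large label,
which extends the chain by one. -/
lemma ConstrainedChain.of_depth {T : GrowingTree} {h : ℕ} {s : ℕ → ℕ}
    (hs : ∀ i v, 1 ≤ v → T.ConstrainedChain h s i v → s i < v) :
    ∀ i v, 1 ≤ v → h + i ≤ T.depth v → T.ConstrainedChain h s i v := by
  intro i
  induction i with
  | zero => intro v _ hv; exact hv
  | succ i ih =>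
    intro v hv hd
    obtain ⟨n, rfl⟩ := Nat.exists_eq_add_of_le' hv
    have hn : 1 ≤ n := by
      by_contra hn
      obtain rfl : n = 0 := by omega
      simp only [zero_add, depth_one] at hd
      omega
    rw [T.depth_succ hn] at hd
    have h1 := T.one_le_parent hn
    have h2 := ih _ h1 (by omega)
    exact ⟨by omega, h2, hs i _ h1 h2⟩

lemma constrainedChain_eq_of_upTo_eq {h : ℕ} {s : ℕ → ℕ} {T T' : GrowingTree} {n : ℕ}
    (he : T.upTo n = T'.upTo n) :
    ∀ i v, v ≤ n → T.ConstrainedChain h s i v = T'.ConstrainedChain h s i v := by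
  intro i
  induction i with
  | zero => intro v hv; simp only [ConstrainedChain, depth_eq_of_upTo_eq he v hv]
  | succ i ih =>
    intro v hv
    by_cases h2 : 2 ≤ v
    · obtain ⟨m, rfl⟩ := Nat.exists_eq_add_of_le' (show 1 ≤ v by omega)
      have hp := T.parent_le (n := m) (by omega)
      simp only [ConstrainedChain, ← parent_eq_of_upTo_eq he h2 hv, ih (T.parent (m + 1)) (by omega)]
    · simp only [ConstrainedChain, h2, false_and]

end GrowingTree

namespace WRT

section Determined

variable {Ω : Type*} {T : Ω → GrowingTree} {w : ℕ → ℝ}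

lemma determined_levelWeight {j s n : ℕ} (h : s ≤ n) :
    Determined T n fun ω => (T ω).levelWeight w j s := by
  intro ω ω' he
  refine Finset.sum_congr rfl fun k hk => ?_
  rw [Finset.mem_Icc] at hk
  rw [GrowingTree.depth_eq_of_upTo_eq he k (by omega)]

lemma determined_levelIncrement {j s n : ℕ} :
    Determined T n fun ω => (T ω).levelIncrement w j s n := by
  intro ω ω' he
  refine Finset.sum_congr rfl fun k hk => ?_
  rw [Finset.mem_Ioc] at hk
  rw [GrowingTree.depth_eq_of_upTo_eq he k (by omega)]

end Determined

variable {Ω : Type*} [MeasurableSpace Ω] {μ : Measure Ω} [IsProbabilityMeasure μ]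
  {w : ℕ → ℝ} {T : Ω → GrowingTree} {aInf : ℝ}

/-- The heights of the vertices are uniformly tight. -/
lemma exists_measureReal_depth_le (hT : IsWRT μ w T) (hw : ∀ n, 1 ≤ n → 0 ≤ w n) (hw1 : 0 < w 1)
    (ha : Tendsto (a w) atTop (𝓝 aInf)) {η : ℝ} (hη : 0 < η) :
    ∃ h : ℕ, ∀ v, 1 ≤ v → μ.real {ω | h ≤ (T ω).depth v} ≤ η := by
  -- Vertices of depth at least `S` have labels above `S`, and a parent falls there with probability
  -- at most `1 / 2`; so each generation beyond `S` halves the probability.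
  have hev : ∀ᶠ n in atTop, aInf - 1 / 2 < a w n := ha.eventually_const_lt (by linarith)
  obtain ⟨S, hS⟩ := hev.exists
  have key : ∀ r v, 1 ≤ v → μ.real {ω | S + r ≤ (T ω).depth v} ≤ (1 / 2 : ℝ) ^ r := by
    intro r
    induction r with
    | zero => intro v _; simp
    | succ r ih =>
      intro v hv
      obtain ⟨n, rfl⟩ := Nat.exists_eq_add_of_le' hv
      rcases Nat.eq_zero_or_pos n with rfl | hn
      · simp only [zero_add, GrowingTree.depth_one]
        rw [show {ω : Ω | S + (r + 1) ≤ 0} = ∅ by ext; simp]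
        simp only [measureReal_empty]
        positivity
      have h1 : {ω | S + (r + 1) ≤ (T ω).depth (n + 1)}
          = {ω | S + r ≤ (T ω).depth ((T ω).parent (n + 1))} := by
        ext ω
        simp only [Set.mem_ofPred_eq, (T ω).depth_succ hn]
        omega
      have h2 := measureReal_comp_parent_le hT hw hw1 ha hn (s := S)
        (p := fun k ω => S + r ≤ (T ω).depth k)
        (fun k _ ω ω' he => by simp only [determined_depth le_rfl he])
        (fun k ω hk hd => by have := (T ω).depth_lt k hk; omega)
        (Q := (1 / 2 : ℝ) ^ r) (by positivity) ih
      rw [h1, pow_succ]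
      refine h2.trans (mul_le_mul_of_nonneg_left (by linarith) (by positivity))
  obtain ⟨r, hr⟩ := exists_pow_lt_of_lt_one hη (show (1 / 2 : ℝ) < 1 by norm_num)
  exact ⟨S + r, fun v hv => (key r v hv).trans hr.le⟩

/-- Since the label constraint is part of the chain event, each generation contributes its own
factor `aInf - a (s i)`, without conditioning on a global good event. -/
lemma measureReal_constrainedChain_le (hT : IsWRT μ w T) (hw : ∀ n, 1 ≤ n → 0 ≤ w n)
    (hw1 : 0 < w 1) (ha : Tendsto (a w) atTop (𝓝 aInf)) {h : ℕ} {s : ℕ → ℕ} {Q : ℕ → ℝ}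
    (hQ : ∀ i, 0 ≤ Q i) (h0 : ∀ v, 1 ≤ v → μ.real {ω | h ≤ (T ω).depth v} ≤ Q 0)
    (hsucc : ∀ i, Q i * (aInf - a w (s i)) ≤ Q (i + 1)) :
    ∀ i v, 1 ≤ v → μ.real {ω | (T ω).ConstrainedChain h s i v} ≤ Q i := by
  intro i
  induction i with
  | zero => exact h0
  | succ i ih =>
    intro v hv
    obtain ⟨n, rfl⟩ := Nat.exists_eq_add_of_le' hv
    rcases Nat.eq_zero_or_pos n with rfl | hn
    · rw [show {ω : Ω | (T ω).ConstrainedChain h s (i + 1) (0 + 1)} = ∅ by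
        ext; simp [GrowingTree.ConstrainedChain]]
      simpa using hQ (i + 1)
    have h2 := measureReal_comp_parent_le hT hw hw1 ha hn (s := s i)
      (p := fun k ω => (T ω).ConstrainedChain h s i k ∧ s i < k)
      (fun k _ ω ω' he => by
        simp only [GrowingTree.constrainedChain_eq_of_upTo_eq he i k le_rfl])
      (fun k ω hk hd => hd.2) (hQ i)
      (fun k hk => (measureReal_mono fun ω hω => hω.1).trans (ih k hk))
    refine le_trans (measureReal_mono ?_) (h2.trans (hsucc i))
    exact fun ω hω => hω.2

/-- With high probability, all vertices of height at least `h + i` have labels larger than `s i`. -/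
theorem measure_exists_depth_le (hT : IsWRT μ w T) (hw : ∀ n, 1 ≤ n → 0 ≤ w n)
    (hw1 : 0 < w 1) (ha : Tendsto (a w) atTop (𝓝 aInf)) {h : ℕ} {s : ℕ → ℕ} {Q : ℕ → ℝ}
    (hQ : ∀ i, 0 ≤ Q i) (h0 : ∀ v, 1 ≤ v → μ.real {ω | h ≤ (T ω).depth v} ≤ Q 0)
    (hsucc : ∀ i, Q i * (aInf - a w (s i)) ≤ Q (i + 1)) :
    μ {ω | ¬ ∀ i v, 1 ≤ v → h + i ≤ (T ω).depth v → s i < v}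
      ≤ ∑' i, ENNReal.ofReal (s i * Q i) := by
  have hsub : {ω | ¬ ∀ i v, 1 ≤ v → h + i ≤ (T ω).depth v → s i < v} ⊆
      ⋃ i, ⋃ v ∈ Finset.Icc 1 (s i), {ω | (T ω).ConstrainedChain h s i v} := by
    intro ω hω
    by_contra hcon
    simp only [Set.mem_iUnion, Set.mem_ofPred_eq, not_exists, Finset.mem_Icc] at hcon
    have hs : ∀ i v, 1 ≤ v → (T ω).ConstrainedChain h s i v → s i < v := fun i v hv hc => by
      by_contra hlt
      exact hcon i v ⟨hv, by omega⟩ hc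
    exact hω fun i v hv hd => hs i v hv (GrowingTree.ConstrainedChain.of_depth hs i v hv hd)
  refine (measure_mono hsub).trans ((measure_iUnion_le _).trans (ENNReal.tsum_le_tsum fun i => ?_))
  refine (measure_biUnion_finset_le _ _).trans ?_
  have hb : ∀ v ∈ Finset.Icc 1 (s i),
      μ {ω | (T ω).ConstrainedChain h s i v} ≤ ENNReal.ofReal (Q i) := by
    intro v hv
    rw [← ofReal_measureReal]
    exact ENNReal.ofReal_le_ofReal
      (measureReal_constrainedChain_le hT hw hw1 ha hQ h0 hsucc i v (Finset.mem_Icc.1 hv).1)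
  refine (Finset.sum_le_sum hb).trans ?_
  rw [Finset.sum_const, Nat.card_Icc, Nat.add_sub_cancel, nsmul_eq_mul,
    ENNReal.ofReal_mul (by positivity), ENNReal.ofReal_natCast]

/-! ### Lower bound: concentration of the weight at high levels. -/

/-- Invert `exp x ≥ 1 + x + x ^ 2 / 2` and use `(1 + x + x ^ 2 / 2) * (1 - x + x ^ 2 / 2) = 1 + x ^
4 / 4`. -/
lemma exp_neg_le_quadratic {x : ℝ} (hx : 0 ≤ x) : Real.exp (-x) ≤ 1 - (x - x ^ 2 / 2) := by
  have h1 := Real.quadratic_le_exp_of_nonneg hx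
  rw [Real.exp_neg]
  refine (inv_anti₀ (by positivity) h1).trans ?_
  rw [inv_le_iff_one_le_mul₀ (by positivity)]
  nlinarith [sq_nonneg (x ^ 2)]

lemma levelIncrement_succ (T : GrowingTree) (w : ℕ → ℝ) (j : ℕ) {s n : ℕ} (h : s ≤ n) :
    T.levelIncrement w j s (n + 1)
      = T.levelIncrement w j s n + if j ≤ T.depth (n + 1) then w (n + 1) else 0 := by
  rw [GrowingTree.levelIncrement, Finset.sum_Ioc_succ_top (by omega)]
  rfl

lemma levelIncrement_nonneg (T : GrowingTree) (hw : ∀ n, 1 ≤ n → 0 ≤ w n) (j s n : ℕ) :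
    0 ≤ T.levelIncrement w j s n := by
  refine Finset.sum_nonneg fun i hi => ?_
  have := hw i (by rw [Finset.mem_Ioc] at hi; omega)
  split_ifs <;> simp [this]

open Classical in
/-- Exponential moment bound for the weight at heights `≥ j + 1` added between times `s` and `m`,
on an event of the past on which the weight at heights `≥ j` is bounded below. -/
lemma integral_exp_levelIncrement_le (hT : IsWRT μ w T) (hw : ∀ n, 1 ≤ n → 0 ≤ w n)
    (hw1 : 0 < w 1) {K : ℝ} (hK : ∀ n, W w n ≤ K) {s j : ℕ} (hs : 1 ≤ s) {E : Ω → Prop}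
    (hE : Determined T s E) {q : ℝ} (hq : 0 ≤ q)
    (hEq : ∀ ω, E ω → q * K ≤ (T ω).levelWeight w j s) {c : ℝ} (hc : 0 ≤ c) {m : ℕ} (hm : s ≤ m) :
    ∫ ω, (if E ω then Real.exp (-(c * (T ω).levelIncrement w (j + 1) s m)) else 0) ∂μ
      ≤ Real.exp (-(q * (c * ∑ i ∈ Finset.Ioc s m, w i
          - c ^ 2 / 2 * ∑ i ∈ Finset.Ioc s m, w i ^ 2))) := by
  induction m, hm using Nat.le_induction with
  | base =>
    simp only [GrowingTree.levelIncrement, Finset.Ioc_self, Finset.sum_empty, mul_zero, neg_zero,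
      Real.exp_zero, sub_zero]
    calc ∫ ω, (if E ω then (1 : ℝ) else 0) ∂μ ≤ ∫ ω, (1 : ℝ) ∂μ := by
          refine integral_mono_of_nonneg (ae_of_all _ fun ω => ?_) (integrable_const _)
            (ae_of_all _ fun ω => ?_) <;> dsimp only <;> split_ifs <;> simp
      _ = 1 := by simp
  | succ n hn ih =>
    have hn1 : 1 ≤ n := hs.trans hn
    have hWn := W_pos hw hw1 hn1
    set g : Ω → ℝ := fun ω =>
      if E ω then Real.exp (-(c * (T ω).levelIncrement w (j + 1) s n)) else 0 with hg
    have hg0 : ∀ ω, 0 ≤ g ω := fun ω => by simp only [hg]; split_ifs <;> positivity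
    have hg1 : ∀ ω, g ω ≤ 1 := fun ω => by
      simp only [hg]
      split_ifs
      · exact Real.exp_le_one_iff.2
          (neg_nonpos.2 (mul_nonneg hc (levelIncrement_nonneg _ hw _ _ _)))
      · simp
    have hgd : Determined T n g := fun ω ω' he => by
      simp only [hg, hE.mono hn he, determined_levelIncrement he]
    set x := c * w (n + 1) with hx
    have hx0 : 0 ≤ x := mul_nonneg hc (hw _ (by omega))
    -- `Y k` is the exponential after step `n + 1` if the parent is `k`: a factor `exp (-x)` appears
    -- exactly when the new vertex has height at least `j + 1`.
    set Y : ℕ → Ω → ℝ := fun k ω => g ω * if j ≤ (T ω).depth k then Real.exp (-x) else 1 with hY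
    have hYd : ∀ k ∈ Finset.Icc 1 n, Determined T n (Y k) := fun k hk ω ω' he => by
      simp only [hY, hgd he, GrowingTree.depth_eq_of_upTo_eq he k (Finset.mem_Icc.1 hk).2]
    have hYb : ∀ k ω, |Y k ω| ≤ 1 := fun k ω => by
      have h1 : Real.exp (-x) ≤ 1 := Real.exp_le_one_iff.2 (by linarith)
      have h2 := (Real.exp_pos (-x)).le
      simp only [hY, abs_mul, abs_of_nonneg (hg0 ω)]
      refine mul_le_one₀ (hg1 ω) (abs_nonneg _) ?_
      split_ifs
      · rwa [abs_of_nonneg h2]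
      · simp
    have hrew : ∀ ω, (if E ω then Real.exp (-(c * (T ω).levelIncrement w (j + 1) s (n + 1))) else 0)
        = Y ((T ω).parent (n + 1)) ω := by
      intro ω
      simp only [hY, hg, levelIncrement_succ _ _ _ hn, (T ω).depth_succ hn1, add_le_add_iff_right]
      split_ifs
      · rw [← Real.exp_add]; congr 1; rw [hx]; ring
      · simp
      · simp
      · simp
    simp_rw [hrew]
    rw [integral_comp_parent hT hn1 hYd hYb]
    have hYi : ∀ k ∈ Finset.Icc 1 n, Integrable (fun ω => w k / W w n * Y k ω) μ :=
      fun k hk => ((hYd k hk).integrable hT (hYb k)).const_mul _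
    have hgi : Integrable g μ := hgd.integrable hT (C := 1) fun ω => by
      rw [abs_of_nonneg (hg0 ω)]; exact hg1 ω
    -- The parent has height at least `j` with probability `p ≥ q`, because the weight at these
    -- heights only grows and `W n ≤ K`. The averaged factor is `1 - (1 - exp (-x)) * p ≤ exp (-q *
    -- (x - x ^ 2 / 2))`.
    have hpt : ∀ ω, ∑ k ∈ Finset.Icc 1 n, w k / W w n * Y k ω
        ≤ Real.exp (-(q * (x - x ^ 2 / 2))) * g ω := by
      intro ω
      by_cases hEω : E ω
      swap
      · simp [hY, hg, hEω]
      have h1 : ∑ k ∈ Finset.Icc 1 n, w k / W w n * Y k ω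
          = g ω * (1 - (1 - Real.exp (-x)) * ((T ω).levelWeight w j n / W w n)) := by
        have h4 : 1 - (1 - Real.exp (-x)) * ((T ω).levelWeight w j n / W w n)
            = (W w n - (1 - Real.exp (-x)) * (T ω).levelWeight w j n) / W w n := by
          field_simp
        rw [h4, W, GrowingTree.levelWeight, Finset.mul_sum, ← Finset.sum_sub_distrib,
          Finset.sum_div, Finset.mul_sum]
        refine Finset.sum_congr rfl fun k _ => ?_
        simp only [hY]
        split_ifs <;> ring
      have h2 : q ≤ (T ω).levelWeight w j n / W w n := by
        rw [le_div_iff₀ hWn]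
        calc q * W w n ≤ q * K := mul_le_mul_of_nonneg_left (hK n) hq
          _ ≤ _ := hEq ω hEω
          _ ≤ _ := (T ω).levelWeight_mono hw j hn
      have h5 : Real.exp (-x) ≤ 1 - (x - x ^ 2 / 2) := exp_neg_le_quadratic hx0
      have h6 : Real.exp (-x) ≤ 1 := Real.exp_le_one_iff.2 (by linarith)
      rw [h1, mul_comm]
      refine mul_le_mul_of_nonneg_right ?_ (hg0 ω)
      have h7 := Real.add_one_le_exp (-(q * (x - x ^ 2 / 2)))
      nlinarith [mul_le_mul_of_nonneg_left h2 (sub_nonneg.2 h6)]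
    calc ∑ k ∈ Finset.Icc 1 n, w k / W w n * ∫ ω, Y k ω ∂μ
        = ∫ ω, ∑ k ∈ Finset.Icc 1 n, w k / W w n * Y k ω ∂μ := by
          rw [integral_finsetSum _ hYi]
          exact Finset.sum_congr rfl fun k _ => (integral_const_mul _ _).symm
      _ ≤ ∫ ω, Real.exp (-(q * (x - x ^ 2 / 2))) * g ω ∂μ :=
          integral_mono (integrable_finsetSum _ hYi) (hgi.const_mul _) hpt
      _ = Real.exp (-(q * (x - x ^ 2 / 2))) * ∫ ω, g ω ∂μ := integral_const_mul _ _
      _ ≤ Real.exp (-(q * (x - x ^ 2 / 2))) * Real.exp (-(q * (c * ∑ i ∈ Finset.Ioc s n, w i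
          - c ^ 2 / 2 * ∑ i ∈ Finset.Ioc s n, w i ^ 2))) :=
          mul_le_mul_of_nonneg_left ih (Real.exp_pos _).le
      _ = _ := by
          rw [← Real.exp_add, Finset.sum_Ioc_succ_top (by omega), Finset.sum_Ioc_succ_top (by omega),
            hx]
          congr 1
          ring

/-- Lower tail bound for the weight at heights `≥ j + 1` added between times `s` and `m`. -/
lemma measureReal_levelIncrement_le (hT : IsWRT μ w T) (hw : ∀ n, 1 ≤ n → 0 ≤ w n)
    (hw1 : 0 < w 1) {K : ℝ} (hK : ∀ n, W w n ≤ K) {s j : ℕ} (hs : 1 ≤ s) {q : ℝ} (hq : 0 ≤ q)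
    {m : ℕ} (hm : s ≤ m) {M S : ℝ} (hM0 : 0 ≤ M) (hM : M ≤ ∑ i ∈ Finset.Ioc s m, w i)
    (hS0 : 0 < S) (hS : ∑ i ∈ Finset.Ioc s m, w i ^ 2 ≤ S) :
    μ.real {ω | q * K ≤ (T ω).levelWeight w j s ∧ (T ω).levelIncrement w (j + 1) s m ≤ q * M / 2}
      ≤ Real.exp (-(q * M ^ 2 / (8 * S))) := by
  classical
  -- This `c` minimises the Chernoff exponent `q * (c ^ 2 * S / 2 - c * M / 2)`, with minimum `-q *
  -- M ^ 2 / (8 * S)`.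
  set c := M / (2 * S) with hc
  have hc0 : 0 ≤ c := by positivity
  have hEd : Determined T s fun ω => q * K ≤ (T ω).levelWeight w j s := fun ω ω' he => by
    simp only [determined_levelWeight le_rfl he]
  have hexp := integral_exp_levelIncrement_le hT hw hw1 hK hs hEd hq (fun _ h => h) hc0 hm
  set g : Ω → ℝ := fun ω => if q * K ≤ (T ω).levelWeight w j s then
    Real.exp (-(c * (T ω).levelIncrement w (j + 1) s m)) else 0 with hg
  have hg0 : ∀ ω, 0 ≤ g ω := fun ω => by simp only [hg]; split_ifs <;> positivity
  have hgi : Integrable g μ := by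
    refine Determined.integrable hT (n := m) (C := 1) (fun ω ω' he => ?_) fun ω => ?_
    · simp only [hg, determined_levelWeight hm he, determined_levelIncrement he]
    · rw [abs_of_nonneg (hg0 ω)]
      simp only [hg]
      split_ifs
      · exact Real.exp_le_one_iff.2
          (neg_nonpos.2 (mul_nonneg hc0 (levelIncrement_nonneg _ hw _ _ _)))
      · simp
  have hmarkov := mul_meas_ge_le_integral_of_nonneg (ae_of_all _ hg0) hgi
    (Real.exp (-(c * (q * M / 2))))
  have hsub : {ω | q * K ≤ (T ω).levelWeight w j s ∧
      (T ω).levelIncrement w (j + 1) s m ≤ q * M / 2} ⊆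
      {ω | Real.exp (-(c * (q * M / 2))) ≤ g ω} := by
    rintro ω ⟨h1, h2⟩
    simp only [Set.mem_ofPred_eq, hg, if_pos h1]
    exact Real.exp_le_exp.2 (neg_le_neg (mul_le_mul_of_nonneg_left h2 hc0))
  have h3 : Real.exp (-(c * (q * M / 2))) * μ.real {ω | q * K ≤ (T ω).levelWeight w j s ∧
      (T ω).levelIncrement w (j + 1) s m ≤ q * M / 2} ≤
      Real.exp (-(q * (c * M - c ^ 2 / 2 * S))) := by
    refine (mul_le_mul_of_nonneg_left (measureReal_mono hsub) (Real.exp_pos _).le).trans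
      (hmarkov.trans (hexp.trans (Real.exp_le_exp.2 (neg_le_neg ?_))))
    have h4 := mul_le_mul_of_nonneg_left hM hc0
    have h5 := mul_le_mul_of_nonneg_left hS (show 0 ≤ c ^ 2 / 2 by positivity)
    exact mul_le_mul_of_nonneg_left (by linarith) hq
  rw [mul_comm, ← le_div_iff₀ (Real.exp_pos _), ← Real.exp_sub] at h3
  refine h3.trans (Real.exp_le_exp.2 (le_of_eq ?_))
  rw [hc]
  field_simp
  ring

/-- With high probability, the height of the tree at time `t j` is at least `j` for all `j`. -/
theorem measure_not_forall_le_height (hT : IsWRT μ w T) (hw : ∀ n, 1 ≤ n → 0 ≤ w n)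
    (hw1 : 0 < w 1) {K : ℝ} (hK0 : 0 < K) (hK : ∀ n, W w n ≤ K) {t : ℕ → ℕ} (ht : Monotone t)
    (ht0 : 1 ≤ t 0) {q M S : ℕ → ℝ} (hq : ∀ j, 0 < q j) (hq0 : q 0 * K ≤ W w (t 0))
    (hM0 : ∀ j, 0 ≤ M j) (hM : ∀ j, M j ≤ ∑ i ∈ Finset.Ioc (t j) (t (j + 1)), w i)
    (hS0 : ∀ j, 0 < S j) (hS : ∀ j, ∑ i ∈ Finset.Ioc (t j) (t (j + 1)), w i ^ 2 ≤ S j)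
    (hsucc : ∀ j, q (j + 1) * K ≤ q j * M j / 2) :
    μ {ω | ¬ ∀ j, j ≤ (T ω).height (t j)}
      ≤ ∑' j, ENNReal.ofReal (Real.exp (-(q j * M j ^ 2 / (8 * S j)))) := by
  have hsub : {ω | ¬ ∀ j, j ≤ (T ω).height (t j)} ⊆
      ⋃ j, {ω | q j * K ≤ (T ω).levelWeight w j (t j) ∧
        (T ω).levelIncrement w (j + 1) (t j) (t (j + 1)) ≤ q j * M j / 2} := by
    intro ω hω
    by_contra hcon
    simp only [Set.mem_iUnion, Set.mem_ofPred_eq, not_exists, not_and, not_le] at hcon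
    -- At level `0` all of the weight counts. If no bad event occurs, the weight added in one window
    -- at the next level is already more than required.
    have hall : ∀ j, q j * K ≤ (T ω).levelWeight w j (t j) := by
      intro j
      induction j with
      | zero => rwa [GrowingTree.levelWeight_zero]
      | succ j ih =>
        have h1 := hcon j ih
        have h2 := (T ω).levelIncrement_le_levelWeight hw (j + 1) (t j) (t (j + 1))
        linarith [hsucc j]
    exact hω fun j => (T ω).le_height_of_levelWeight_pos ((mul_pos (hq j) hK0).trans_le (hall j))
  refine (measure_mono hsub).trans ((measure_iUnion_le _).trans (ENNReal.tsum_le_tsum fun j => ?_))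
  rw [← ofReal_measureReal]
  exact ENNReal.ofReal_le_ofReal (measureReal_levelIncrement_le hT hw hw1 hK
    (ht0.trans (ht (Nat.zero_le j))) (hq j).le (ht (Nat.le_succ j)) (hM0 j) (hM j) (hS0 j) (hS j))

end WRT

/-! ### Slow variation on the logarithmic scale. -/

namespace WRT

section SlowVariation

/-- The uniform convergence theorem for slowly varying functions, in additive form. -/
lemma eventually_uniform_of_slowlyVarying {f : ℝ → ℝ} (hf : Measurable f)
    (h : ∀ u, Tendsto (fun y => f (y + u) - f y) atTop (𝓝 0)) {η : ℝ} (hη : 0 < η) :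
    ∀ᶠ y in atTop, ∀ u ∈ Set.Icc (0 : ℝ) 1, |f (y + u) - f y| ≤ η := by
  -- `B y` collects the bad shifts in `[0, 2]`; by pointwise convergence its measure tends to zero.
  set B : ℝ → Set ℝ := fun y => Set.Icc 0 2 ∩ {u | η / 2 ≤ |f (y + u) - f y|} with hB
  have hBm : ∀ y, MeasurableSet (B y) := fun y => by
    refine measurableSet_Icc.inter (measurableSet_le measurable_const ?_)
    have : Measurable fun u => f (y + u) := hf.comp (measurable_const_add y)
    exact (this.sub measurable_const).abs
  have hlim : Tendsto (fun y => volume (B y)) atTop (𝓝 (volume (∅ : Set ℝ))) := by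
    refine tendsto_measure_of_ae_tendsto_indicator atTop MeasurableSet.empty hBm
      (measurableSet_Icc (a := (0 : ℝ)) (b := 2)) (by simp)
      (Eventually.of_forall fun y => Set.inter_subset_left) (ae_of_all _ fun u => ?_)
    have := (h u).abs
    rw [abs_zero] at this
    filter_upwards [this.eventually_lt_const (half_pos hη)] with y hy
    simp only [hB, Set.mem_inter_iff, Set.mem_ofPred_eq, Set.mem_empty_iff_false, iff_false, not_and,
      not_le]
    exact fun _ => hy
  rw [measure_empty] at hlim
  have hlt : ∀ᶠ y in atTop, volume (B y) < ENNReal.ofReal (1 / 2) :=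
    hlim.eventually_lt_const (by simp)
  obtain ⟨Y, hY⟩ := eventually_atTop.1 hlt
  filter_upwards [eventually_ge_atTop Y] with y hy u hu
  -- The interval `[u, 2]` has length at least one and the two bad sets have measure below `1 / 2`
  -- each, so some `v` is a good shift from `y` while `v - u` is a good shift from `y + u`. Both
  -- lead to `y + v`, and comparing them bounds `f (y + u) - f y`.
  have hex : ∃ v ∈ Set.Icc u 2, v ∉ B y ∧ v - u ∉ B (y + u) := by
    by_contra hcon
    push Not at hcon
    have hsub : Set.Icc u 2 ⊆ B y ∪ (fun v => v - u) ⁻¹' B (y + u) := fun v hv => by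
      by_cases h1 : v ∈ B y
      · exact Or.inl h1
      · exact Or.inr (hcon v hv h1)
    have h1 := (measure_mono hsub).trans (measure_union_le (μ := volume) _ _)
    have h2 : volume ((fun v => v - u) ⁻¹' B (y + u)) = volume (B (y + u)) :=
      by simpa only [sub_eq_add_neg] using measure_preimage_add_right volume (-u) (B (y + u))
    rw [h2, Real.volume_Icc] at h1
    have h3 := h1.trans_lt (ENNReal.add_lt_add (hY y hy) (hY (y + u) (by linarith [hu.1])))
    rw [← ENNReal.ofReal_add (by norm_num) (by norm_num), ENNReal.ofReal_lt_ofReal_iff (by norm_num)]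
      at h3
    linarith [hu.2]
  obtain ⟨v, hv, h1, h2⟩ := hex
  simp only [hB, Set.mem_inter_iff, Set.mem_ofPred_eq, not_and, not_le] at h1 h2
  have h3 := h1 ⟨hu.1.trans hv.1, hv.2⟩
  have h4 := h2 ⟨by linarith [hv.1], by linarith [hv.2, hu.1]⟩
  rw [show y + u + (v - u) = y + v by ring] at h4
  rw [abs_lt] at h3 h4
  rw [abs_le]
  constructor <;> linarith

/-- Chain the uniform bound over steps of length one. -/
lemma eventually_le_of_slowlyVarying {f : ℝ → ℝ} (hf : Measurable f)
    (h : ∀ u, Tendsto (fun y => f (y + u) - f y) atTop (𝓝 0)) {η : ℝ} (hη : 0 < η) :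
    ∀ᶠ y in atTop, ∀ u, 0 ≤ u → |f (y + u) - f y| ≤ η * (1 + u) := by
  obtain ⟨Y, hY⟩ := eventually_atTop.1 (eventually_uniform_of_slowlyVarying hf h hη)
  have key : ∀ n : ℕ, ∀ y ≥ Y, ∀ u ∈ Set.Icc (0 : ℝ) 1, |f (y + n + u) - f y| ≤ η * (1 + n) := by
    intro n
    induction n with
    | zero => intro y hy u hu; simpa using hY y hy u hu
    | succ n ih =>
      intro y hy u hu
      have h1 := ih (y + 1) (by linarith) u hu
      have h2 := hY y hy 1 (by simp)
      rw [abs_le] at h1 h2 ⊢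
      push_cast
      rw [show y + 1 + n + u = y + (n + 1) + u by ring] at h1
      constructor <;> linarith
  filter_upwards [eventually_ge_atTop Y] with y hy u hu
  have h1 := key ⌊u⌋₊ y hy (u - ⌊u⌋₊)
    ⟨by linarith [Nat.floor_le hu], by linarith [Nat.lt_floor_add_one u]⟩
  rw [show y + ⌊u⌋₊ + (u - ⌊u⌋₊) = y + u by ring] at h1
  exact h1.trans (mul_le_mul_of_nonneg_left (by linarith [Nat.floor_le hu]) hη.le)

variable {J : ℝ → ℝ}

lemma SlowlyVarying.eventually_log_le (hJpos : ∀ x, 1 ≤ x → 0 < J x) (hJ : SlowlyVarying J)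
    {η : ℝ} (hη : 0 < η) :
    ∀ᶠ y in atTop, ∀ u, 0 ≤ u →
      |Real.log (J (Real.exp (y + u))) - Real.log (J (Real.exp y))| ≤ η * (1 + u) := by
  -- `J` is controlled only on `[1, ∞)`, hence the truncation at `0`.
  set f : ℝ → ℝ := fun y => Real.log (J (Real.exp (max y 0))) with hf
  have hfm : Measurable f := by
    refine Real.measurable_log.comp ?_
    have h1 : Measurable fun y : ℝ => (⟨Real.exp (max y 0), by
        simp [Set.mem_Ici]⟩ : Set.Ici (1 : ℝ)) :=
      Measurable.subtype_mk (by fun_prop)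
    exact hJ.measurable.comp h1
  have hlim : ∀ u, Tendsto (fun y => f (y + u) - f y) atTop (𝓝 0) := by
    intro u
    have h1 := (hJ.tendsto (Real.exp u) (Real.exp_pos u)).comp Real.tendsto_exp_atTop
    have h2 := (Real.continuousAt_log one_ne_zero).tendsto.comp h1
    rw [Real.log_one] at h2
    refine h2.congr' ?_
    filter_upwards [eventually_ge_atTop 0, eventually_ge_atTop (-u)] with y hy hyu
    have hy' : 0 ≤ y + u := by linarith
    simp only [Function.comp, hf, max_eq_left hy, max_eq_left hy']
    rw [← Real.exp_add, add_comm u y, Real.log_div (hJpos _ (Real.one_le_exp hy')).ne'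
      (hJpos _ (Real.one_le_exp hy)).ne']
  filter_upwards [eventually_le_of_slowlyVarying hfm hlim hη, eventually_ge_atTop 0]
    with y hy hy0 u hu
  have := hy u hu
  simp only [hf, max_eq_left hy0, max_eq_left (add_nonneg hy0 hu)] at this
  exact this

/-- The derivative of `log (J (exp y))` is `x * J' x / J x` at `x = exp y`, which tends to zero. The
mean value inequality gives an error without additive constant, as needed for `β < 1 / 2`, where the
relevant `u` may tend to zero. -/
lemma SmoothlySlowlyVarying.eventually_log_le (hJpos : ∀ x, 1 ≤ x → 0 < J x)
    (hJ : SmoothlySlowlyVarying 2 J) {η : ℝ} (hη : 0 < η) :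
    ∀ᶠ y in atTop, ∀ u, 0 ≤ u →
      |Real.log (J (Real.exp (y + u))) - Real.log (J (Real.exp y))| ≤ η * u := by
  have hd : DifferentiableOn ℝ J (Set.Ici 1) := by
    simpa using hJ.differentiableOn 0 (by norm_num)
  have ht := (hJ.tendsto 1 le_rfl (by norm_num)).comp Real.tendsto_exp_atTop
  simp only [pow_one, iteratedDerivWithin_one] at ht
  have ht' := ht.abs
  rw [abs_zero] at ht'
  obtain ⟨Y, hY⟩ := eventually_atTop.1
    ((ht'.eventually_lt_const hη).and (eventually_gt_atTop (0 : ℝ)))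
  have hderiv : ∀ y ≥ Y, HasDerivWithinAt (fun y => Real.log (J (Real.exp y)))
      (Real.exp y * derivWithin J (Set.Ici 1) (Real.exp y) / J (Real.exp y)) (Set.Ici Y) y := by
    intro y hy
    have h1 : 1 < Real.exp y := Real.one_lt_exp_iff.2 (hY y hy).2
    have h2 : HasDerivAt J (derivWithin J (Set.Ici 1) (Real.exp y)) (Real.exp y) :=
      ((hd _ h1.le).hasDerivWithinAt).hasDerivAt (Ici_mem_nhds h1)
    have h3 := (h2.comp y (Real.hasDerivAt_exp y)).log (hJpos _ h1.le).ne'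
    rw [mul_comm] at h3
    exact h3.hasDerivWithinAt
  filter_upwards [eventually_ge_atTop Y] with y hy u hu
  have := (convex_Ici Y).norm_image_sub_le_of_norm_hasDerivWithin_le (C := η)
    (fun x hx => hderiv x hx) (fun x hx => (hY x hx).1.le) (x := y) (y := y + u) hy
    (Set.mem_Ici.2 (by linarith [show Y ≤ y from hy]))
  simpa [abs_of_nonneg hu] using this

/-- The common consequence of the two assumptions on `J`. -/
lemma eventually_log_le {β : ℝ} (hJpos : ∀ x, 1 ≤ x → 0 < J x)
    (hJ2 : β < 1 / 2 → SmoothlySlowlyVarying 2 J) (hJ0 : 1 / 2 ≤ β → SlowlyVarying J)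
    {η : ℝ} (hη : 0 < η) :
    ∀ᶠ y in atTop, ∀ x u, 1 ≤ x → 0 ≤ u →
      |Real.log (J (Real.exp (y + u))) - Real.log (J (Real.exp y))|
        ≤ η * (x ^ min (2 * β - 1) 0 + u) := by
  rcases lt_or_ge β (1 / 2) with h | h
  · filter_upwards [(hJ2 h).eventually_log_le hJpos hη] with y hy x u hx hu
    refine (hy u hu).trans (mul_le_mul_of_nonneg_left ?_ hη.le)
    have : 0 ≤ x ^ min (2 * β - 1) 0 := Real.rpow_nonneg (by linarith) _
    linarith
  · filter_upwards [(hJ0 h).eventually_log_le hJpos hη] with y hy x u hx hu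
    rw [min_eq_right (by linarith), Real.rpow_zero]
    exact hy u hu

/-- Compare with one fixed base point at slope `η / 2`; for large `y` the rest of the slope absorbs
the constants. -/
lemma eventually_abs_le_mul {f : ℝ → ℝ}
    (hf : ∀ η > 0, ∀ᶠ y in atTop, ∀ u, 0 ≤ u → |f (y + u) - f y| ≤ η * (1 + u))
    {η : ℝ} (hη : 0 < η) : ∀ᶠ y in atTop, |f y| ≤ η * y := by
  obtain ⟨Y, hY, hY0⟩ := ((hf (η / 2) (by positivity)).and (eventually_ge_atTop 0)).exists
  filter_upwards [eventually_ge_atTop Y, eventually_ge_atTop (2 / η * (|f Y| + η / 2))]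
    with y hy hy2
  have h1 := hY (y - Y) (by linarith)
  rw [add_sub_cancel] at h1
  have h2 : |f y| ≤ |f y - f Y| + |f Y| := by
    simpa using abs_add_le (f y - f Y) (f Y)
  have h3 : |f Y| + η / 2 ≤ η / 2 * y := by
    have := mul_le_mul_of_nonneg_left hy2 (show 0 ≤ η / 2 by positivity)
    rwa [← mul_assoc, show η / 2 * (2 / η) = 1 by field_simp, one_mul] at this
  nlinarith [mul_nonneg hη.le hY0]

end SlowVariation

/-- Put `h = c * x ^ (β - 1)`. From `log (1 + h) ≥ h / (1 + h)` follows `(1 + h) ^ β ≥ 1 + β * h /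
(1 + h)`; then `h ≤ c` if `β ≤ 1` and `h ≥ c` if `β > 1`. -/
lemma rpow_add_le_of_add_rpow_le {β c x z : ℝ} (hβ : 0 < β) (hc : 0 < c) (hx : 1 ≤ x)
    (hz : x + c * x ^ β ≤ z) :
    x ^ β + β * c / (1 + c) * x ^ min (2 * β - 1) 0 ≤ z ^ β := by
  have hx0 : 0 < x := by linarith
  set h := c * x ^ (β - 1) with hh
  have hh0 : 0 < h := by positivity
  have hxh : x + c * x ^ β = x * (1 + h) := by
    rw [hh, mul_add, mul_one, mul_left_comm, ← Real.rpow_one_add' hx0.le (by linarith)]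
    ring_nf
  have h1 : x ^ β * (1 + h) ^ β ≤ z ^ β := by
    rw [← Real.mul_rpow hx0.le (by positivity), ← hxh]
    exact Real.rpow_le_rpow (by positivity) hz hβ.le
  have h2 : 1 + β * (h / (1 + h)) ≤ (1 + h) ^ β := by
    rw [Real.rpow_def_of_pos (by positivity)]
    have h3 := Real.one_sub_inv_le_log_of_pos (show 0 < 1 + h by positivity)
    have h4 : 1 - (1 + h)⁻¹ = h / (1 + h) := by field_simp; ring
    have h5 := Real.add_one_le_exp (Real.log (1 + h) * β)
    rw [h4] at h3
    nlinarith
  have h6 : c / (1 + c) * x ^ min (2 * β - 1) 0 ≤ x ^ β * (h / (1 + h)) := by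
    rcases le_or_gt β 1 with hb | hb
    · have h7 : x ^ (β - 1) ≤ 1 := Real.rpow_le_one_of_one_le_of_nonpos hx (by linarith)
      have h8 : h ≤ c := by rw [hh]; nlinarith
      have h9 : h / (1 + c) ≤ h / (1 + h) :=
        div_le_div_of_nonneg_left hh0.le (by positivity) (by linarith)
      calc c / (1 + c) * x ^ min (2 * β - 1) 0 ≤ c / (1 + c) * x ^ (2 * β - 1) :=
            mul_le_mul_of_nonneg_left
              (Real.rpow_le_rpow_of_exponent_le hx (min_le_left _ _)) (by positivity)
        _ = x ^ β * (h / (1 + c)) := by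
            rw [hh, show 2 * β - 1 = β + (β - 1) by ring, Real.rpow_add hx0]; ring
        _ ≤ _ := mul_le_mul_of_nonneg_left h9 (by positivity)
    · have h7 : 1 ≤ x ^ (β - 1) := Real.one_le_rpow hx (by linarith)
      have h8 : c ≤ h := by rw [hh]; nlinarith
      have h9 : c / (1 + c) ≤ h / (1 + h) := by
        rw [div_le_div_iff₀ (by positivity) (by positivity)]; nlinarith
      rw [mul_comm]
      refine mul_le_mul ?_ h9 (by positivity) (by positivity)
      exact Real.rpow_le_rpow_of_exponent_le hx ((min_le_right _ _).trans hβ.le)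
  have h10 : 0 ≤ x ^ β := by positivity
  calc x ^ β + β * c / (1 + c) * x ^ min (2 * β - 1) 0
      = x ^ β + β * (c / (1 + c) * x ^ min (2 * β - 1) 0) := by ring
    _ ≤ x ^ β + β * (x ^ β * (h / (1 + h))) := by gcongr
    _ = x ^ β * (1 + β * (h / (1 + h))) := by ring
    _ ≤ x ^ β * (1 + h) ^ β := mul_le_mul_of_nonneg_left h2 h10
    _ ≤ _ := h1

lemma tendsto_log_natCast : Tendsto (fun n : ℕ => Real.log n) atTop atTop :=
  Real.tendsto_log_atTop.comp tendsto_natCast_atTop_atTop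

/-! ### Decay of `aInf - a n` and its increments over windows. -/

section Tail

variable {w : ℕ → ℝ} {α β aInf : ℝ} {J : ℝ → ℝ} {r : ℕ → ℝ}

lemma mainTerm_eq (hJpos : ∀ x, 1 ≤ x → 0 < J x) {n : ℕ} (hn : 1 ≤ n) :
    mainTerm α β J n
      = Real.exp (-(α - 1) * Real.log n ^ β + Real.log (J (Real.exp (Real.log n ^ β)))) := by
  have h0 : 0 ≤ Real.log n := Real.log_nonneg (by exact_mod_cast hn)
  rw [mainTerm, Real.exp_add, Real.exp_log (hJpos _ (Real.one_le_exp (Real.rpow_nonneg h0 _)))]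

lemma eventually_abs_error_le
    (hr : r =o[atTop] (fun n : ℕ => Real.log n ^ min (4 * β - 2) 0)) {η : ℝ} (hη : 0 < η) :
    ∀ᶠ n : ℕ in atTop, |r n| ≤ η * Real.log n ^ min (2 * β - 1) 0 := by
  filter_upwards [hr.bound hη, tendsto_log_natCast.eventually_ge_atTop 1] with n hn h1
  refine hn.trans (mul_le_mul_of_nonneg_left ?_ hη.le)
  rw [Real.norm_of_nonneg (Real.rpow_nonneg (by linarith) _)]
  refine Real.rpow_le_rpow_of_exponent_le h1 (le_min ?_ (min_le_right _ _))
  rcases le_total (2 * β - 1) 0 with h | h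
  · exact (min_le_left _ _).trans (by linarith)
  · exact (min_le_right _ _).trans h

lemma rpow_min_zero_le_one {x : ℝ} (hx : 1 ≤ x) (e : ℝ) : x ^ min e 0 ≤ 1 :=
  Real.rpow_le_one_of_one_le_of_nonpos hx (min_le_right _ _)

/-- `J (exp y)` is `exp (o(y))` and `1 + r n` lies between `exp (-1)` and `exp 1`; each costs at
most half of `η * (log n) ^ β`. -/
lemma tail_bounds (hβ : 0 < β) (hJpos : ∀ x, 1 ≤ x → 0 < J x)
    (hJ2 : β < 1 / 2 → SmoothlySlowlyVarying 2 J) (hJ0 : 1 / 2 ≤ β → SlowlyVarying J)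
    (hr : r =o[atTop] (fun n : ℕ => Real.log n ^ min (4 * β - 2) 0))
    (hA : ∀ n, 1 ≤ n → aInf - a w n = mainTerm α β J n * (1 + r n)) {η : ℝ} (hη : 0 < η) :
    ∀ᶠ n : ℕ in atTop, Real.exp (-(α - 1 + η) * Real.log n ^ β) ≤ aInf - a w n ∧
      aInf - a w n ≤ Real.exp (-(α - 1 - η) * Real.log n ^ β) := by
  have hlog : Tendsto (fun n : ℕ => Real.log n ^ β) atTop atTop :=
    (tendsto_rpow_atTop hβ).comp tendsto_log_natCast
  have hf : ∀ᶠ y in atTop, |Real.log (J (Real.exp y))| ≤ η / 2 * y := by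
    refine eventually_abs_le_mul (f := fun y => Real.log (J (Real.exp y))) (fun η' hη' => ?_)
      (half_pos hη)
    filter_upwards [eventually_log_le hJpos hJ2 hJ0 hη'] with y hy u hu
    simpa using hy 1 u le_rfl hu
  filter_upwards [hlog.eventually hf, eventually_abs_error_le hr (show (0 : ℝ) < 1 / 2 by norm_num),
    eventually_ge_atTop 1, tendsto_log_natCast.eventually_ge_atTop 1,
    hlog.eventually_ge_atTop (2 / η)] with n h1 h2 hn hlog1 h3
  have h4 : |r n| ≤ 1 / 2 := h2.trans (by
    have := rpow_min_zero_le_one hlog1 (2 * β - 1); linarith)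
  rw [abs_le] at h1 h4
  have h5 : 1 ≤ η / 2 * Real.log n ^ β := by
    have := mul_le_mul_of_nonneg_left h3 (show 0 ≤ η / 2 by positivity)
    rwa [show η / 2 * (2 / η) = 1 by field_simp] at this
  have h6 : Real.exp (-1) ≤ 1 + r n := by
    have := Real.exp_neg_one_lt_half
    linarith
  have h7 : 1 + r n ≤ Real.exp 1 := by linarith [Real.add_one_le_exp (1 : ℝ)]
  rw [hA n hn, mainTerm_eq hJpos hn]
  constructor
  · refine le_trans ?_ (mul_le_mul_of_nonneg_left h6 (Real.exp_pos _).le)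
    rw [← Real.exp_add]
    exact Real.exp_le_exp.2 (by linarith)
  · refine (mul_le_mul_of_nonneg_left h7 (Real.exp_pos _).le).trans ?_
    rw [← Real.exp_add]
    exact Real.exp_le_exp.2 (by linarith)

/-- The increment of `a` over a window whose logarithmic length is of order `(log n) ^ β`. -/
lemma window_mass (hα : 1 < α) (hβ : 0 < β) (hJpos : ∀ x, 1 ≤ x → 0 < J x)
    (hJ2 : β < 1 / 2 → SmoothlySlowlyVarying 2 J) (hJ0 : 1 / 2 ≤ β → SlowlyVarying J)
    (hr : r =o[atTop] (fun n : ℕ => Real.log n ^ min (4 * β - 2) 0))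
    (hA : ∀ n, 1 ≤ n → aInf - a w n = mainTerm α β J n * (1 + r n)) {c : ℝ} (hc : 0 < c) :
    ∀ᶠ n : ℕ in atTop, ∀ m : ℕ, Real.log n + c * Real.log n ^ β ≤ Real.log m →
      (aInf - a w n) / Real.log n ≤ a w m - a w n := by
  set k := β * c / (1 + c) with hk
  have hk0 : 0 < k := by positivity
  -- Over the window `(log n) ^ β` grows by `u ≥ k * θ`, a gain of `(α - 1) * u` in the exponent.
  -- The losses are `η * (θ + u)` from `J` and `3 * η * θ` from the two error terms, so `η * (k + 4)
  -- ≤ (α - 1) * k / 2` leaves the net gain `d * θ`.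
  set η := min (1 / 2) ((α - 1) * k / (2 * (k + 4))) with hη_def
  have hα' : 0 < α - 1 := by linarith
  have hη : 0 < η := by positivity
  have hη1 : η ≤ 1 / 2 := min_le_left _ _
  have hη2 : η * (k + 4) ≤ (α - 1) * k / 2 := by
    have := min_le_right (1 / 2) ((α - 1) * k / (2 * (k + 4)))
    rw [← hη_def, le_div_iff₀ (by positivity)] at this
    linarith
  have hη3 : η ≤ α - 1 := by
    by_contra hcon
    nlinarith
  set d := (α - 1) * k / 2 with hd
  have hd0 : 0 < d := by positivity
  have hlog : Tendsto (fun n : ℕ => Real.log n ^ β) atTop atTop :=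
    (tendsto_rpow_atTop hβ).comp tendsto_log_natCast
  obtain ⟨N, hN⟩ := eventually_atTop.1 (eventually_abs_error_le hr hη)
  have hexp : 0 < 1 + min (2 * β - 1) 0 := by
    rcases min_choice (2 * β - 1) 0 with h | h <;> rw [h] <;> linarith
  have hlim : Tendsto (fun n : ℕ => Real.log n ^ (1 + min (2 * β - 1) 0)) atTop atTop :=
    (tendsto_rpow_atTop hexp).comp tendsto_log_natCast
  filter_upwards [hlog.eventually (eventually_log_le hJpos hJ2 hJ0 hη), eventually_ge_atTop N,
    eventually_ge_atTop 1, tendsto_log_natCast.eventually_ge_atTop 1,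
    hlim.eventually_ge_atTop ((1 + d) / d)] with n hJn hNn hn hx1 hlarge m hm
  set x := Real.log n with hx
  set z := Real.log m with hz
  set θ := x ^ min (2 * β - 1) 0 with hθ
  have hx0 : 0 < x := by linarith
  have hθ0 : 0 < θ := Real.rpow_pos_of_pos hx0 _
  have hθ1 : θ ≤ 1 := rpow_min_zero_le_one hx1 _
  have hxz : x ≤ z := by
    have : 0 ≤ c * x ^ β := by positivity
    linarith
  have hm1 : 1 ≤ m := by
    rcases Nat.eq_zero_or_pos m with h | h
    · rw [hz, h] at hxz; simp at hxz; linarith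
    · exact h
  have hnm : n ≤ m := by
    have := (Real.log_le_log_iff (by exact_mod_cast hn) (by exact_mod_cast hm1)).1 hxz
    exact_mod_cast this
  have hu : k * θ ≤ z ^ β - x ^ β := by
    have := rpow_add_le_of_add_rpow_le hβ hc hx1 hm
    linarith
  set u := z ^ β - x ^ β with hu_def
  have hu0 : 0 ≤ u := le_trans (by positivity) hu
  have hJ' := (abs_le.1 (hJn x u hx1 hu0)).2
  rw [show x ^ β + u = z ^ β by rw [hu_def]; ring] at hJ'
  have hrn := (abs_le.1 (hN n hNn)).1
  have hrm : r m ≤ η * θ := by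
    refine (abs_le.1 (hN m (hNn.trans hnm))).2.trans (mul_le_mul_of_nonneg_left ?_ hη.le)
    exact Real.rpow_le_rpow_of_nonpos hx0 hxz (min_le_right _ _)
  have hηθ : η * θ ≤ 1 / 2 := by nlinarith
  have hη0θ : 0 ≤ η * θ := by positivity
  have hrn1 : 0 < 1 + r n := by linarith
  have hrn' : Real.exp (-(2 * (η * θ))) ≤ 1 + r n := by
    have h1 : Real.exp (-(2 * (η * θ))) ≤ (1 + 2 * (η * θ))⁻¹ := by
      rw [Real.exp_neg]
      exact inv_anti₀ (by positivity) (by linarith [Real.add_one_le_exp (2 * (η * θ))])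
    have h2 : (1 + 2 * (η * θ))⁻¹ ≤ 1 - η * θ := by
      rw [inv_le_iff_one_le_mul₀ (by positivity)]; nlinarith
    linarith
  have hrm' : 1 + r m ≤ Real.exp (η * θ) := by linarith [Real.add_one_le_exp (η * θ)]
  have hratio : aInf - a w m ≤ Real.exp (-(d * θ)) * (aInf - a w n) := by
    rw [hA n hn, hA m hm1, mainTerm_eq hJpos hn, mainTerm_eq hJpos hm1]
    refine (mul_le_mul_of_nonneg_left hrm' (Real.exp_pos _).le).trans ?_
    refine le_trans ?_ (mul_le_mul_of_nonneg_left
      (mul_le_mul_of_nonneg_left hrn' (Real.exp_pos _).le) (Real.exp_pos _).le)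
    rw [← Real.exp_add, ← Real.exp_add, ← Real.exp_add]
    refine Real.exp_le_exp.2 ?_
    rw [← hx, ← hz]
    have h1 : (α - 1 - η) * (k * θ) ≤ (α - 1 - η) * u :=
      mul_le_mul_of_nonneg_left hu (by linarith)
    have h2 : η * (k + 4) * θ ≤ (α - 1) * k / 2 * θ := mul_le_mul_of_nonneg_right hη2 hθ0.le
    have h3 : z ^ β = x ^ β + u := by rw [hu_def]; ring
    rw [h3]
    rw [h3] at hJ'
    rw [hd]
    nlinarith
  have hAn : 0 ≤ aInf - a w n := by
    rw [hA n hn, mainTerm_eq hJpos hn]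
    positivity
  -- `1 - exp (-(d * θ))` is at least of order `θ`, and `x * θ` is a positive power of `x`, hence
  -- large: a fraction `1 / log n` of the tail lies in the window.
  have hfin : 1 / x ≤ 1 - Real.exp (-(d * θ)) := by
    have h1 : Real.exp (-(d * θ)) ≤ (1 + d * θ)⁻¹ := by
      rw [Real.exp_neg]
      exact inv_anti₀ (by positivity) (by linarith [Real.add_one_le_exp (d * θ)])
    have h2 : d * θ / (1 + d) ≤ 1 - (1 + d * θ)⁻¹ := by
      have h3 : 1 - (1 + d * θ)⁻¹ = d * θ / (1 + d * θ) := by field_simp; ring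
      rw [h3]
      exact div_le_div_of_nonneg_left (by positivity) (by positivity) (by nlinarith)
    have h4 : 1 / x ≤ d * θ / (1 + d) := by
      rw [Real.rpow_add hx0, Real.rpow_one, ← hθ, div_le_iff₀ hd0] at hlarge
      rw [div_le_div_iff₀ hx0 (by positivity)]
      linarith
    linarith
  calc (aInf - a w n) / x = 1 / x * (aInf - a w n) := by ring
    _ ≤ (1 - Real.exp (-(d * θ))) * (aInf - a w n) := mul_le_mul_of_nonneg_right hfin hAn
    _ ≤ a w m - a w n := by linarith

end Tail

end WRT

/-! ### Rounding, orbits and the almost sure bounds on the height. -/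

namespace WRT

section Rounding

lemma tendsto_floor_exp : Tendsto (fun x : ℝ => ⌊Real.exp x⌋₊) atTop atTop :=
  tendsto_nat_floor_atTop.comp Real.tendsto_exp_atTop

lemma tendsto_ceil_exp : Tendsto (fun x : ℝ => ⌈Real.exp x⌉₊) atTop atTop :=
  tendsto_nat_ceil_atTop.comp Real.tendsto_exp_atTop

lemma tendsto_log_div_of_div_exp {g : ℝ → ℕ}
    (hg : Tendsto (fun x => (g x : ℝ) / Real.exp x) atTop (𝓝 1)) :
    Tendsto (fun x => Real.log (g x) / x) atTop (𝓝 1) := by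
  have h1 := (Real.continuousAt_log one_ne_zero).tendsto.comp hg
  rw [Real.log_one] at h1
  have h2 : Tendsto (fun x => 1 + Real.log ((g x : ℝ) / Real.exp x) * x⁻¹) atTop (𝓝 (1 + 0 * 0)) :=
    tendsto_const_nhds.add (h1.mul tendsto_inv_atTop_zero)
  rw [mul_zero, add_zero] at h2
  refine h2.congr' ?_
  filter_upwards [hg.eventually_const_lt zero_lt_one, eventually_gt_atTop 0] with x hx hx0
  have hgx : (g x : ℝ) ≠ 0 := by
    intro h; rw [h, zero_div] at hx; exact lt_irrefl _ hx
  rw [Real.log_div hgx (Real.exp_pos x).ne', Real.log_exp]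
  field_simp
  ring

lemma tendsto_log_floor_exp_div :
    Tendsto (fun x : ℝ => Real.log (⌊Real.exp x⌋₊ : ℝ) / x) atTop (𝓝 1) :=
  tendsto_log_div_of_div_exp (tendsto_nat_floor_div_atTop.comp Real.tendsto_exp_atTop)

lemma tendsto_log_ceil_exp_div :
    Tendsto (fun x : ℝ => Real.log (⌈Real.exp x⌉₊ : ℝ) / x) atTop (𝓝 1) :=
  tendsto_log_div_of_div_exp (tendsto_nat_ceil_div_atTop.comp Real.tendsto_exp_atTop)

/-- If `g x / x → 1`, then `c * (g x) ^ β` and `c * x ^ β` are comparable. -/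
lemma eventually_mul_rpow_le {g : ℝ → ℝ} (hg : Tendsto (fun x => g x / x) atTop (𝓝 1)) {b c d : ℝ}
    (hcd : c < d) :
    ∀ᶠ x in atTop, c * x ^ b ≤ d * g x ^ b ∧ c * g x ^ b ≤ d * x ^ b := by
  have h1 : Tendsto (fun x => (g x / x) ^ b) atTop (𝓝 1) := by
    have := hg.rpow_const (p := b) (Or.inl one_ne_zero)
    rwa [Real.one_rpow] at this
  have h2 : Tendsto (fun x => d * (g x / x) ^ b) atTop (𝓝 (d * 1)) := tendsto_const_nhds.mul h1
  have h3 : Tendsto (fun x => c * (g x / x) ^ b) atTop (𝓝 (c * 1)) := tendsto_const_nhds.mul h1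
  rw [mul_one] at h2 h3
  filter_upwards [h2.eventually_const_lt hcd, h3.eventually_lt_const hcd,
    hg.eventually_const_lt zero_lt_one, eventually_gt_atTop 0] with x h4 h5 h6 hx
  have hgx : 0 < g x := by
    by_contra h
    exact absurd h6 (not_lt.2 (div_nonpos_of_nonpos_of_nonneg (not_lt.1 h) hx.le))
  have hxb : 0 < x ^ b := Real.rpow_pos_of_pos hx b
  rw [Real.div_rpow hgx.le hx.le, mul_div_assoc'] at h4 h5
  exact ⟨((lt_div_iff₀ hxb).1 h4).le, ((div_lt_iff₀ hxb).1 h5).le⟩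

end Rounding

/-- A property that fails with arbitrarily small probability holds almost surely. -/
lemma ae_of_forall_measure_le {Ω : Type*} [MeasurableSpace Ω] {μ : Measure Ω} {p : Ω → Prop}
    {b : ℝ → ℝ} (hb : Tendsto b atTop (𝓝 0))
    (h : ∀ᶠ x in atTop, μ {ω | ¬ p ω} ≤ ENNReal.ofReal (b x)) : ∀ᵐ ω ∂μ, p ω := by
  rw [ae_iff]
  have h1 : Tendsto (fun x => ENNReal.ofReal (b x)) atTop (𝓝 0) := by
    simpa using ENNReal.tendsto_ofReal hb
  exact le_antisymm (ge_of_tendsto h1 h) zero_le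

/-- The bound is geometric and tends to zero as the starting point `l` grows. -/
lemma tsum_ofReal_exp_le {c l : ℝ} (hc : 0 < c) {L : ℕ → ℝ} (hL : ∀ i, l + i ≤ L i) :
    ∑' i, ENNReal.ofReal (Real.exp (-(c * L i)))
      ≤ ENNReal.ofReal (Real.exp (-(c * l)) * (1 - Real.exp (-c))⁻¹) := by
  have hlt : Real.exp (-c) < 1 := Real.exp_lt_one_iff.2 (by linarith)
  have hs := (hasSum_geometric_of_lt_one (Real.exp_pos (-c)).le hlt).mul_left (Real.exp (-(c * l)))
  have hnn : ∀ i : ℕ, 0 ≤ Real.exp (-(c * l)) * Real.exp (-c) ^ i := fun i => by positivity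
  rw [← hs.tsum_eq, ENNReal.ofReal_tsum_of_nonneg hnn hs.summable]
  refine ENNReal.tsum_le_tsum fun i => ENNReal.ofReal_le_ofReal ?_
  rw [← Real.exp_nat_mul, ← Real.exp_add]
  refine Real.exp_le_exp.2 ?_
  nlinarith [hL i]

lemma tendsto_exp_neg_mul_const {c C : ℝ} (hc : 0 < c) :
    Tendsto (fun l : ℝ => Real.exp (-(c * l)) * C) atTop (𝓝 0) := by
  have h1 : Tendsto (fun l : ℝ => Real.exp (-(c * l))) atTop (𝓝 0) :=
    Real.tendsto_exp_neg_atTop_nhds_zero.comp (tendsto_id.const_mul_atTop hc)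
  simpa using h1.mul_const C

section Iteration

/-- The orbit of `l` under `L ↦ L + g L`. -/
noncomputable def orbit (g : ℝ → ℝ) (l : ℝ) : ℕ → ℝ
  | 0 => l
  | i + 1 => orbit g l i + g (orbit g l i)

variable {g : ℝ → ℝ} {l : ℝ}

lemma add_le_orbit (hg : ∀ L, l ≤ L → 1 ≤ g L) (i : ℕ) : l + i ≤ orbit g l i := by
  induction i with
  | zero => simp [orbit]
  | succ i ih =>
    have hi : (0 : ℝ) ≤ i := Nat.cast_nonneg i
    have := hg (orbit g l i) (by linarith)
    rw [orbit]
    push_cast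
    linarith

lemma le_orbit (hg : ∀ L, l ≤ L → 1 ≤ g L) (i : ℕ) : l ≤ orbit g l i := by
  have := add_le_orbit hg i
  have hi : (0 : ℝ) ≤ i := Nat.cast_nonneg i
  linarith

lemma orbit_mono (hg : ∀ L, l ≤ L → 1 ≤ g L) : Monotone (orbit g l) :=
  monotone_nat_of_le_succ fun i => by
    have := hg _ (le_orbit hg i)
    rw [orbit]
    linarith

lemma mul_le_apply_orbit {Ψ : ℝ → ℝ} {d : ℝ} (hg : ∀ L, l ≤ L → 1 ≤ g L) (hl : 0 ≤ Ψ l)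
    (hΨ : ∀ L, l ≤ L → Ψ L + d ≤ Ψ (L + g L)) (i : ℕ) : i * d ≤ Ψ (orbit g l i) := by
  induction i with
  | zero => simpa [orbit] using hl
  | succ i ih =>
    have := hΨ _ (le_orbit hg i)
    rw [orbit]
    push_cast
    linarith

lemma apply_orbit_le {Ψ : ℝ → ℝ} {d : ℝ} (hg : ∀ L, l ≤ L → 1 ≤ g L)
    (hΨ : ∀ L, l ≤ L → Ψ (L + g L) ≤ Ψ L + d) (i : ℕ) : Ψ (orbit g l i) ≤ Ψ l + i * d := by
  induction i with
  | zero => simp [orbit]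
  | succ i ih =>
    have := hΨ _ (le_orbit hg i)
    rw [orbit]
    push_cast
    linarith

end Iteration

lemma eventually_forall_ge {p : ℝ → Prop} (h : ∀ᶠ x in atTop, p x) :
    ∀ᶠ l in atTop, ∀ L, l ≤ L → p L := eventually_forall_ge_atTop.2 h

lemma tendsto_mul_rpow_atTop {β c k : ℝ} (hβ : 0 < β) (hc : 0 < c) (hk : 0 < k) :
    Tendsto (fun L : ℝ => c * (k * L) ^ β) atTop atTop :=
  ((tendsto_rpow_atTop hβ).comp (tendsto_id.const_mul_atTop hk)).const_mul_atTop hc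

variable {Ω : Type*} [MeasurableSpace Ω] {μ : Measure Ω} [IsProbabilityMeasure μ]
  {w : ℕ → ℝ} {T : Ω → GrowingTree} {aInf α β : ℝ} {Ψ : ℝ → ℝ}

/-- Upper bound for the height in terms of a function `Ψ` that grows by at least `1 - δ` along the
recursion `L ↦ L + (1 - ε) (α - 1) ((1 - ε) L) ^ β`. -/
theorem ae_height_le (hT : IsWRT μ w T) (hw : ∀ n, 1 ≤ n → 0 ≤ w n) (hw1 : 0 < w 1)
    (ha : Tendsto (a w) atTop (𝓝 aInf)) (hα : 1 < α) (hβ : 0 < β)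
    (htail : ∀ η > 0, ∀ᶠ n : ℕ in atTop, aInf - a w n ≤ Real.exp (-(α - 1 - η) * Real.log n ^ β))
    {x₀ : ℝ} (hmono : StrictMonoOn Ψ (Set.Ici x₀)) (hlim : Tendsto Ψ atTop atTop)
    {δ ε : ℝ} (hδ : δ < 1) (hε0 : 0 < ε) (hε1 : ε < 1)
    (hinc : ∀ᶠ L in atTop, Ψ L + (1 - δ) ≤ Ψ (L + (1 - ε) * (α - 1) * ((1 - ε) * L) ^ β)) :
    ∀ᵐ ω ∂μ, ∃ C : ℝ, ∀ᶠ n : ℕ in atTop,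
      ((T ω).height n : ℝ) ≤ C + Ψ (Real.log n / (1 - ε)) / (1 - δ) := by
  have hα' : 0 < α - 1 := by linarith
  have hε' : 0 < 1 - ε := by linarith
  have hδ' : 0 < 1 - δ := by linarith
  set g : ℝ → ℝ := fun L => (1 - ε) * (α - 1) * ((1 - ε) * L) ^ β with hg
  have hglim : Tendsto g atTop atTop := tendsto_mul_rpow_atTop hβ (by positivity) hε'
  have htail' : ∀ᶠ x : ℝ in atTop,
      aInf - a w ⌊Real.exp x⌋₊ ≤ Real.exp (-((1 - ε) * (α - 1) * x ^ β)) := by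
    have hη : 0 < ε * (α - 1) / 2 := by positivity
    filter_upwards [tendsto_floor_exp.eventually (htail _ hη),
      eventually_mul_rpow_le tendsto_log_floor_exp_div (b := β) (c := (1 - ε) * (α - 1))
        (d := α - 1 - ε * (α - 1) / 2) (by nlinarith)] with x h1 h2
    refine h1.trans (Real.exp_le_exp.2 ?_)
    linarith [h2.1]
  have hscale : Tendsto (fun L : ℝ => (1 - ε) * L) atTop atTop := tendsto_id.const_mul_atTop hε'
  refine ae_of_forall_measure_le (tendsto_exp_neg_mul_const (C := (1 - Real.exp (-ε))⁻¹) hε0) ?_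
  filter_upwards [eventually_forall_ge (hscale.eventually htail'), eventually_forall_ge hinc,
    eventually_forall_ge (hglim.eventually_ge_atTop 1), eventually_ge_atTop x₀,
    hlim.eventually_ge_atTop 0] with l hl1 hl2 hl3 hl4 hl5
  set L := orbit g l with hL
  have hLl : ∀ i, l ≤ L i := le_orbit hl3
  obtain ⟨h, hh⟩ := exists_measureReal_depth_le hT hw hw1 ha (Real.exp_pos (-l))
  -- With `Q i = exp (-L i)` and `log (s i)` about `(1 - ε) * L i`, the increment of the orbit is
  -- exactly the available decay exponent, and `s i * Q i ≤ exp (-ε * L i)` is summable.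
  have hmain := measure_exists_depth_le hT hw hw1 ha (h := h)
    (s := fun i => ⌊Real.exp ((1 - ε) * L i)⌋₊) (Q := fun i => Real.exp (-L i))
    (fun i => (Real.exp_pos _).le) hh (fun i => by
      refine (mul_le_mul_of_nonneg_left (hl1 (L i) (hLl i)) (Real.exp_pos _).le).trans ?_
      rw [← Real.exp_add]
      refine Real.exp_le_exp.2 (le_of_eq ?_)
      simp only [hL, orbit, hg]
      ring)
  refine (measure_mono ?_).trans (hmain.trans (le_trans (ENNReal.tsum_le_tsum fun i => ?_)
    (tsum_ofReal_exp_le hε0 (add_le_orbit hl3))))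
  swap
  · refine ENNReal.ofReal_le_ofReal ?_
    refine (mul_le_mul_of_nonneg_right (Nat.floor_le (Real.exp_pos _).le)
      (Real.exp_pos _).le).trans ?_
    rw [← Real.exp_add]
    exact Real.exp_le_exp.2 (le_of_eq (by ring))
  intro ω hω hgood
  refine hω ⟨h + 1, ?_⟩
  have hscale' : Tendsto (fun n : ℕ => Real.log n / (1 - ε)) atTop atTop :=
    tendsto_log_natCast.atTop_div_const hε'
  filter_upwards [hscale'.eventually_ge_atTop x₀, (hlim.comp hscale').eventually_ge_atTop 0,
    eventually_ge_atTop 1] with n hn1 hn2 hn3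
  simp only [Function.comp] at hn2
  -- After this many steps the orbit has passed `log n / (1 - ε)`, so `n ≤ s i` and no vertex of the
  -- tree at time `n` reaches height `h + i`.
  set i := ⌈Ψ (Real.log n / (1 - ε)) / (1 - δ)⌉₊ with hi
  have hi1 : Ψ (Real.log n / (1 - ε)) ≤ i * (1 - δ) := by
    rw [← div_le_iff₀ hδ']; exact Nat.le_ceil _
  have hi2 : (i : ℝ) < Ψ (Real.log n / (1 - ε)) / (1 - δ) + 1 :=
    Nat.ceil_lt_add_one (by positivity)
  have hLi : Real.log n / (1 - ε) ≤ L i := by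
    by_contra hcon
    have h1 := hmono (hl4.trans (hLl i)) hn1 (not_le.1 hcon)
    have h2 := mul_le_apply_orbit hl3 hl5 hl2 i
    linarith
  have hns : n ≤ ⌊Real.exp ((1 - ε) * L i)⌋₊ := by
    refine Nat.le_floor ?_
    rw [← Real.log_le_iff_le_exp (by exact_mod_cast hn3)]
    rwa [div_le_iff₀' hε'] at hLi
  have hheight : (T ω).height n ≤ h + i := by
    rw [GrowingTree.height_le_iff]
    intro v hv1 hvn
    by_contra hcon
    have := hgood i v hv1 (by omega)
    omega
  have : ((T ω).height n : ℝ) ≤ h + i := by exact_mod_cast hheight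
  linarith

/-- Lower bound for the height in terms of a function `Ψ` that grows by at most `1 + δ` along the
recursion `L ↦ L + (1 + ε) (α - 1) (κ L) ^ β`. -/
theorem ae_le_height (hT : IsWRT μ w T) (hw : ∀ n, 1 ≤ n → 0 ≤ w n) (hw1 : 0 < w 1)
    (ha : Tendsto (a w) atTop (𝓝 aInf)) (hα : 1 < α) (hβ : 0 < β)
    (htail : ∀ η > 0, ∀ᶠ n : ℕ in atTop, Real.exp (-(α - 1 + η) * Real.log n ^ β) ≤ aInf - a w n)
    (hmass : ∀ c > 0, ∀ᶠ n : ℕ in atTop, ∀ m : ℕ, Real.log n + c * Real.log n ^ β ≤ Real.log m →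
      (aInf - a w n) / Real.log n ≤ a w m - a w n)
    {κ η : ℝ} (hκ : 1 ≤ κ) (hη : 0 < η)
    (hsq : ∀ᶠ n : ℕ in atTop, sqTail w n ≤ (n : ℝ) ^ (-(1 / κ + η)) * (aInf - a w n) ^ 2)
    {x₀ : ℝ} (hmono : StrictMonoOn Ψ (Set.Ici x₀)) (hlim : Tendsto Ψ atTop atTop)
    {δ ε : ℝ} (hδ : 0 < δ) (hε0 : 0 < ε)
    (hinc : ∀ᶠ L in atTop, Ψ (L + (1 + ε) * (α - 1) * (κ * L) ^ β) ≤ Ψ L + (1 + δ)) :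
    ∀ᵐ ω ∂μ, ∃ C : ℝ, ∀ᶠ n : ℕ in atTop,
      Ψ (Real.log n / κ) / (1 + δ) - C ≤ ((T ω).height n : ℝ) := by
  have hα' : 0 < α - 1 := by linarith
  have hκ0 : 0 < κ := by linarith
  obtain ⟨K, hK0, hK⟩ := exists_W_le hw hw1 ha
  set g : ℝ → ℝ := fun L => (1 + ε) * (α - 1) * (κ * L) ^ β with hg
  have hglim : Tendsto g atTop atTop := tendsto_mul_rpow_atTop hβ (by positivity) hκ0
  set ν : ℝ → ℕ := fun x => ⌈Real.exp x⌉₊ with hν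
  have hνlim : Tendsto ν atTop atTop := tendsto_ceil_exp
  have hνx : ∀ x, Real.exp x ≤ ν x := fun x => Nat.le_ceil _
  have hν0 : ∀ x, (0 : ℝ) < ν x := fun x => (Real.exp_pos x).trans_le (hνx x)
  have hxν : ∀ x, x ≤ Real.log (ν x) := fun x => (Real.le_log_iff_exp_le (hν0 x)).2 (hνx x)
  have hνx1 : ∀ x, 0 ≤ x → Real.log (ν x) ≤ x + 1 := fun x hx => by
    rw [Real.log_le_iff_le_exp (hν0 x), Real.exp_add]
    have h1 := Nat.ceil_lt_add_one (Real.exp_pos x).le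
    have h2 := Real.one_le_exp hx
    have h3 := Real.add_one_le_exp (1 : ℝ)
    have h4 : (ν x : ℝ) < Real.exp x + 1 := h1
    nlinarith
  -- the window reaches far enough
  have hreach : ∀ᶠ x : ℝ in atTop, ∀ z : ℝ, x + (α - 1) * x ^ β ≤ z →
      Real.log (ν x) + (α - 1) / 2 * Real.log (ν x) ^ β ≤ Real.log (ν z) := by
    have h1 : Tendsto (fun x : ℝ => (α - 1) / 4 * (1 * x) ^ β) atTop atTop :=
      tendsto_mul_rpow_atTop hβ (by positivity) one_pos
    -- Of the length `(α - 1) * x ^ β`, three quarters cover the window started at the rounded point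
    -- and one quarter covers the rounding error, at most one.
    filter_upwards [h1.eventually_ge_atTop 1, eventually_ge_atTop 0,
      eventually_mul_rpow_le tendsto_log_ceil_exp_div (b := β) (c := (α - 1) / 2)
        (d := (α - 1) * (3 / 4)) (by linarith)] with x h2 h3 h4 z hz
    rw [one_mul] at h2
    have h5 := h4.2
    have h6 := hνx1 x h3
    have h7 := hxν z
    change (α - 1) / 2 * Real.log (ν x) ^ β ≤ _ at h5
    linarith
  have hmass' : ∀ᶠ x : ℝ in atTop, ∀ z : ℝ, x + (α - 1) * x ^ β ≤ z →
      (aInf - a w (ν x)) / Real.log (ν x) ≤ a w (ν z) - a w (ν x) := by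
    filter_upwards [hreach, hνlim.eventually (hmass ((α - 1) / 2) (by positivity))]
      with x h1 h2 z hz
    exact h2 _ (h1 z hz)
  -- the mass of a window is large enough
  have hlow : ∀ᶠ x : ℝ in atTop, Real.exp (-((1 + ε) * (α - 1) * x ^ β)) * K
      ≤ w 1 * ((aInf - a w (ν x)) / Real.log (ν x)) / 2 := by
    have hη' : 0 < ε * (α - 1) / 4 := by positivity
    -- Half of the surplus `ε * (α - 1) * x ^ β` pays for the logarithm and the constants.
    have h1 : Tendsto (fun x : ℝ => x * Real.exp (-(ε * (α - 1) / 2) * x ^ β)) atTop (𝓝 0) := by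
      have h2 := (tendsto_rpow_mul_exp_neg_mul_atTop_nhds_zero (1 / β) (ε * (α - 1) / 2)
        (by positivity)).comp (tendsto_rpow_atTop hβ)
      refine h2.congr' ?_
      filter_upwards [eventually_ge_atTop 0] with x hx
      simp only [Function.comp]
      rw [← Real.rpow_mul hx, mul_one_div, div_self hβ.ne', Real.rpow_one]
    have h3 : 0 < w 1 / (4 * K) := by positivity
    filter_upwards [hνlim.eventually (htail _ hη'), h1.eventually_lt_const h3,
      eventually_mul_rpow_le tendsto_log_ceil_exp_div (b := β) (c := α - 1 + ε * (α - 1) / 4)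
        (d := (1 + ε / 2) * (α - 1)) (by nlinarith), eventually_ge_atTop 1] with x h4 h5 h6 hx
    have h7 : Real.log (ν x) ≤ 2 * x := by linarith [hνx1 x (by linarith)]
    have h8 : 0 < Real.log (ν x) := by linarith [hxν x]
    have h9 : (α - 1 + ε * (α - 1) / 4) * Real.log (ν x) ^ β ≤ (1 + ε / 2) * (α - 1) * x ^ β := h6.2
    have h10 : Real.exp (-((1 + ε / 2) * (α - 1) * x ^ β)) ≤ aInf - a w (ν x) :=
      le_trans (Real.exp_le_exp.2 (by linarith)) h4
    have h11 : Real.exp (-((1 + ε) * (α - 1) * x ^ β))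
        = Real.exp (-((1 + ε / 2) * (α - 1) * x ^ β)) * Real.exp (-(ε * (α - 1) / 2) * x ^ β) := by
      rw [← Real.exp_add]; ring_nf
    rw [lt_div_iff₀ (by positivity)] at h5
    rw [mul_div_assoc', div_div, le_div_iff₀ (by positivity), h11]
    set e1 := Real.exp (-((1 + ε / 2) * (α - 1) * x ^ β))
    set e2 := Real.exp (-(ε * (α - 1) / 2) * x ^ β)
    have he1 : 0 < e1 := Real.exp_pos _
    have he2 : 0 < e2 := Real.exp_pos _
    calc e1 * e2 * K * (Real.log (ν x) * 2) ≤ e1 * e2 * K * (2 * x * 2) := by gcongr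
      _ = e1 * (x * e2 * (4 * K)) := by ring
      _ ≤ e1 * w 1 := by gcongr
      _ ≤ (aInf - a w (ν x)) * w 1 := by gcongr
      _ = _ := by ring
  -- the concentration exponent is large
  have hexp : ∀ᶠ L : ℝ in atTop,
      L * (8 * K ^ 2) * (κ * L + 1) ^ 2 ≤ w 1 ^ 2 * Real.exp (κ * η * L) := by
    have h1 : Tendsto (fun L : ℝ => L ^ (3 : ℝ) * Real.exp (-(κ * η) * L)) atTop (𝓝 0) :=
      tendsto_rpow_mul_exp_neg_mul_atTop_nhds_zero 3 (κ * η) (by positivity)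
    have h2 : 0 < w 1 ^ 2 / (8 * K ^ 2 * (κ + 1) ^ 2) := by positivity
    filter_upwards [h1.eventually_lt_const h2, eventually_ge_atTop 1] with L h3 hL
    rw [lt_div_iff₀ (by positivity), show (3 : ℝ) = (3 : ℕ) by norm_num, Real.rpow_natCast] at h3
    have h4 : κ * L + 1 ≤ (κ + 1) * L := by linarith
    have h5 : Real.exp (-(κ * η) * L) * Real.exp (κ * η * L) = 1 := by
      rw [← Real.exp_add]; simp
    calc L * (8 * K ^ 2) * (κ * L + 1) ^ 2 ≤ L * (8 * K ^ 2) * ((κ + 1) * L) ^ 2 := by gcongr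
      _ = L ^ 3 * (8 * K ^ 2 * (κ + 1) ^ 2) *
          (Real.exp (-(κ * η) * L) * Real.exp (κ * η * L)) := by rw [h5]; ring
      _ = L ^ 3 * Real.exp (-(κ * η) * L) * (8 * K ^ 2 * (κ + 1) ^ 2) * Real.exp (κ * η * L) := by
          ring
      _ ≤ w 1 ^ 2 * Real.exp (κ * η * L) := by gcongr
  have hscale : Tendsto (fun L : ℝ => κ * L) atTop atTop := tendsto_id.const_mul_atTop hκ0
  have hpos : ∀ᶠ n : ℕ in atTop, 0 < aInf - a w n := by
    filter_upwards [htail 1 one_pos] with n hn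
    exact (Real.exp_pos _).trans_le hn
  have hsmall : ∀ᶠ l : ℝ in atTop, Real.exp (-l) * K ≤ w 1 := by
    have h1 := tendsto_exp_neg_mul_const (C := K) one_pos
    filter_upwards [h1.eventually_lt_const hw1] with l hl
    rw [one_mul] at hl
    exact hl.le
  refine ae_of_forall_measure_le (tendsto_exp_neg_mul_const (C := (1 - Real.exp (-1))⁻¹) one_pos) ?_
  filter_upwards [eventually_forall_ge (hscale.eventually hmass'),
    eventually_forall_ge (hscale.eventually hlow), eventually_forall_ge hexp,
    eventually_forall_ge hinc, eventually_forall_ge (hglim.eventually_ge_atTop 1),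
    eventually_forall_ge ((hνlim.comp hscale).eventually hsq),
    eventually_forall_ge ((hνlim.comp hscale).eventually hpos), hsmall, eventually_ge_atTop x₀,
    eventually_ge_atTop 1] with l hl1 hl2 hl3 hl4 hl5 hl6 hl7 hl8 hl9 hl10
  simp only [Function.comp] at hl6 hl7
  set L := orbit g l with hL
  have hLl : ∀ i, l ≤ L i := le_orbit hl5
  have hL1 : ∀ i, 1 ≤ L i := fun i => hl10.trans (hLl i)
  set t : ℕ → ℕ := fun j => ν (κ * L j) with ht
  have htmono : Monotone t := fun i j hij =>
    Nat.ceil_mono (Real.exp_le_exp.2 (mul_le_mul_of_nonneg_left (orbit_mono hl5 hij) hκ0.le))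
  have ht1 : ∀ j, 1 ≤ t j := fun j => by
    have := hν0 (κ * L j)
    exact_mod_cast this
  have hlogt : ∀ j, 0 < Real.log (t j) := fun j => by
    have h1 : κ * L j ≤ Real.log (t j) := hxν (κ * L j)
    nlinarith [hL1 j]
  have hAt : ∀ j, 0 < aInf - a w (t j) := fun j => hl7 (L j) (hLl j)
  have hmain := measure_not_forall_le_height hT hw hw1 hK0 hK htmono (ht1 0)
    (q := fun j => Real.exp (-L j))
    (M := fun j => w 1 * ((aInf - a w (t j)) / Real.log (t j)))
    (S := fun j => K ^ 2 * ((t j : ℝ) ^ (-(1 / κ + η)) * (aInf - a w (t j)) ^ 2))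
    (fun j => Real.exp_pos _)
    (hl8.trans (W_one w ▸ W_mono hw (ht1 0)))
    (fun j => mul_nonneg hw1.le (div_nonneg (hAt j).le (hlogt j).le))
    (fun j => by
      refine le_trans (mul_le_mul_of_nonneg_left (hl1 (L j) (hLl j) (κ * L (j + 1)) ?_) hw1.le)
        (mul_a_sub_a_le hw hw1 (htmono (Nat.le_succ j)))
      simp only [hL, orbit, hg]
      have h1 : 0 ≤ (α - 1) * (κ * orbit g l j) ^ β :=
        mul_nonneg hα'.le (Real.rpow_nonneg (mul_nonneg hκ0.le (by linarith [hL1 j])) _)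
      -- As `κ * (1 + ε) ≥ 1`, the step from `κ * L j` to `κ * L (j + 1)` is long enough for the
      -- mass estimate.
      have h2 : 1 ≤ κ * (1 + ε) := by nlinarith
      nlinarith [mul_le_mul_of_nonneg_right h2 h1])
    (fun j => by
      have h1 := hAt j
      have h2 : (0 : ℝ) < t j := by exact_mod_cast ht1 j
      positivity)
    (fun j => (sum_sq_le hw hw1 ha hK (ht1 j)).trans
      (mul_le_mul_of_nonneg_left (hl6 (L j) (hLl j)) (sq_nonneg K)))
    (fun j => by
      have h1 := hl2 (L j) (hLl j)
      have h2 : Real.exp (-L (j + 1))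
          = Real.exp (-L j) * Real.exp (-((1 + ε) * (α - 1) * (κ * L j) ^ β)) := by
        rw [← Real.exp_add]
        simp only [hL, orbit, hg]
        ring_nf
      rw [h2, mul_assoc, mul_div_assoc]
      exact mul_le_mul_of_nonneg_left h1 (Real.exp_pos _).le)
  refine (measure_mono ?_).trans (hmain.trans (le_trans (ENNReal.tsum_le_tsum fun j => ?_)
    (tsum_ofReal_exp_le one_pos (add_le_orbit hl5))))
  swap
  -- The factor `(aInf - a (t j)) ^ 2` cancels between `M j ^ 2` and `S j`. As `t j` is at least
  -- `exp (κ * L j)`, the power `1 / κ` of it compensates `q j = exp (-L j)`, and the power `η`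
  -- beats the logarithms.
  · refine ENNReal.ofReal_le_ofReal (Real.exp_le_exp.2 (neg_le_neg ?_))
    have h1 := hAt j
    have h2 : (0 : ℝ) < t j := by exact_mod_cast ht1 j
    have h3 := hlogt j
    have h4 : Real.log (t j) ≤ κ * L j + 1 := hνx1 _ (by nlinarith [hL1 j])
    have h5 : Real.exp (κ * L j) ≤ t j := hνx (κ * L j)
    have h6 : Real.exp (L j + κ * η * L j) ≤ (t j : ℝ) ^ (1 / κ + η) := by
      have : Real.exp (L j + κ * η * L j) = Real.exp (κ * L j) ^ (1 / κ + η) := by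
        rw [← Real.exp_mul]; congr 1; field_simp
      rw [this]
      exact Real.rpow_le_rpow (Real.exp_pos _).le h5 (by positivity)
    have h7 := hl3 (L j) (hLl j)
    rw [one_mul, Real.rpow_neg h2.le, le_div_iff₀ (by positivity)]
    have h8 : 0 < L j := by linarith [hL1 j]
    have h9 : L j * (8 * K ^ 2) * Real.log (t j) ^ 2
        ≤ Real.exp (-L j) * w 1 ^ 2 * (t j : ℝ) ^ (1 / κ + η) := by
      calc L j * (8 * K ^ 2) * Real.log (t j) ^ 2
          ≤ L j * (8 * K ^ 2) * (κ * L j + 1) ^ 2 := by gcongr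
        _ ≤ w 1 ^ 2 * Real.exp (κ * η * L j) := h7
        _ = Real.exp (-L j) * w 1 ^ 2 * Real.exp (L j + κ * η * L j) := by
            have : Real.exp (κ * η * L j) = Real.exp (-L j) * Real.exp (L j + κ * η * L j) := by
              rw [← Real.exp_add]; ring_nf
            rw [this]; ring
        _ ≤ _ := by gcongr
    set R := (t j : ℝ) ^ (1 / κ + η) with hR
    have hR0 : 0 < R := Real.rpow_pos_of_pos h2 _
    set A := aInf - a w (t j)
    set l' := Real.log (t j)
    have h10 : orbit g l j * (8 * (K ^ 2 * (R⁻¹ * A ^ 2)))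
        = (L j * (8 * K ^ 2) * l' ^ 2) * (A ^ 2 / (R * l' ^ 2)) := by
      field_simp
      rw [hL]
    have h11 : Real.exp (-L j) * (w 1 * (A / l')) ^ 2
        = (Real.exp (-L j) * w 1 ^ 2 * R) * (A ^ 2 / (R * l' ^ 2)) := by
      field_simp
    rw [h10, h11]
    exact mul_le_mul_of_nonneg_right h9 (by positivity)
  intro ω hω hgood
  refine hω ⟨Ψ l / (1 + δ) + 1, ?_⟩
  have hscale' : Tendsto (fun n : ℕ => Real.log n / κ) atTop atTop :=
    tendsto_log_natCast.atTop_div_const hκ0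
  filter_upwards [hscale'.eventually_ge_atTop x₀, (hlim.comp hscale').eventually_ge_atTop (Ψ l),
    eventually_ge_atTop 1] with n hn1 hn2 hn3
  simp only [Function.comp] at hn2
  have hδ' : 0 < 1 + δ := by linarith
  -- After this many steps the orbit is still below `log n / κ`, so `t j ≤ n`.
  set j := ⌊(Ψ (Real.log n / κ) - Ψ l) / (1 + δ)⌋₊ with hj
  have hj1 : j * (1 + δ) ≤ Ψ (Real.log n / κ) - Ψ l := by
    rw [← le_div_iff₀ hδ']
    exact Nat.floor_le (div_nonneg (by linarith) hδ'.le)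
  have hj2 : (Ψ (Real.log n / κ) - Ψ l) / (1 + δ) < j + 1 := Nat.lt_floor_add_one _
  have hLj : L j ≤ Real.log n / κ := by
    by_contra hcon
    have h1 := hmono hn1 (hl9.trans (hLl j)) (not_le.1 hcon)
    have h2 := apply_orbit_le hl5 hl4 j
    linarith
  have htn : t j ≤ n := by
    refine Nat.ceil_le.2 ?_
    rw [← Real.le_log_iff_exp_le (by exact_mod_cast hn3)]
    rwa [le_div_iff₀' hκ0] at hLj
  have hheight : j ≤ (T ω).height n := (hgood j).trans ((T ω).height_mono htn)
  have : (j : ℝ) ≤ (T ω).height n := by exact_mod_cast hheight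
  rw [sub_div] at hj2
  linarith

end WRT

/-! ### Step-counting functions in the three regimes. -/

namespace WRT

/-- `Ψ` has increments close to `ρ c` along the recursion `L ↦ L + c L ^ β`, with `ρ b = 1`, and is
regularly varying. -/
structure IsHeightScale (Ψ : ℝ → ℝ) (b β : ℝ) (ρ σ : ℝ → ℝ) : Prop where
  strictMonoOn : ∃ x₀, StrictMonoOn Ψ (Set.Ici x₀)
  tendsto : Tendsto Ψ atTop atTop
  increment : ∀ c, 0 < c → Tendsto (fun L => Ψ (L + c * L ^ β) - Ψ L) atTop (𝓝 (ρ c))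
  scale : ∀ k, 0 < k → Tendsto (fun L => Ψ (k * L) / Ψ L) atTop (𝓝 (σ k))
  continuousAt_increment : ContinuousAt ρ b
  increment_eq : ρ b = 1
  continuousAt_scale : ContinuousAt σ 1
  scale_one : σ 1 = 1

section Scales

/-- `Ψ` is a primitive of `1 / (b * L ^ β)`, the time taken by the flow `L' = b * L ^ β`. Since `c *
L ^ (β - 1)` tends to zero, one step is infinitesimal relative to `L`, and its increment is read off
from the derivative of `x ^ (1 - β)` at `1`. -/
lemma isHeightScale_of_lt_one {b β : ℝ} (hb : 0 < b) (hβ : β < 1) :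
    IsHeightScale (fun L => L ^ (1 - β) / (b * (1 - β))) b β (fun c => c / b)
      (fun k => k ^ (1 - β)) where
  strictMonoOn := by
    refine ⟨0, fun x hx y _ hxy => ?_⟩
    have hβ' : 0 < 1 - β := by linarith
    exact div_lt_div_of_pos_right (Real.rpow_lt_rpow hx hxy hβ') (by positivity)
  tendsto := by
    have hβ' : 0 < 1 - β := by linarith
    exact (tendsto_rpow_atTop hβ').atTop_div_const (by positivity)
  increment := by
    intro c hc
    have hβ' : 0 < 1 - β := by linarith
    have hd : HasDerivAt (fun x : ℝ => x ^ (1 - β)) (1 - β) 1 := by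
      simpa using Real.hasDerivAt_rpow_const (x := 1) (p := 1 - β) (Or.inl one_ne_zero)
    rw [hasDerivAt_iff_tendsto_slope_zero] at hd
    have hh : Tendsto (fun L : ℝ => c * L ^ (-(1 - β))) atTop (𝓝[≠] 0) := by
      refine tendsto_nhdsWithin_iff.2 ⟨?_, ?_⟩
      · simpa using (tendsto_rpow_neg_atTop hβ').const_mul c
      · filter_upwards [eventually_gt_atTop 0] with L hL
        have := Real.rpow_pos_of_pos hL (-(1 - β))
        exact (mul_pos hc this).ne'
    have h1 := ((hd.comp hh).const_mul c).div_const (b * (1 - β))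
    rw [show c * (1 - β) / (b * (1 - β)) = c / b by field_simp] at h1
    refine h1.congr' ?_
    filter_upwards [eventually_gt_atTop 0] with L hL
    have hL1 : 0 < L ^ (1 - β) := Real.rpow_pos_of_pos hL _
    have h2 : L + c * L ^ β = L * (1 + c * L ^ (-(1 - β))) := by
      have h3 : L * L ^ (-(1 - β)) = L ^ β := by
        nth_rewrite 1 [← Real.rpow_one L]
        rw [← Real.rpow_add hL, show 1 + -(1 - β) = β by ring]
      rw [mul_add, mul_one, mul_left_comm, h3]
    have h4 : 0 < 1 + c * L ^ (-(1 - β)) := by positivity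
    rw [h2, Real.mul_rpow hL.le h4.le]
    simp only [Function.comp, smul_eq_mul, Real.one_rpow]
    have h5 : (c * L ^ (-(1 - β)))⁻¹ = L ^ (1 - β) / c := by
      rw [Real.rpow_neg hL.le]
      field_simp
    rw [h5]
    field_simp
  scale := by
    intro k hk
    refine tendsto_const_nhds.congr' ?_
    filter_upwards [eventually_gt_atTop 0] with L hL
    have hL1 : 0 < L ^ (1 - β) := Real.rpow_pos_of_pos hL _
    have hβ' : 0 < 1 - β := by linarith
    rw [Real.mul_rpow hk.le hL.le]
    field_simp
  continuousAt_increment := by fun_prop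
  increment_eq := div_self hb.ne'
  continuousAt_scale := Real.continuousAt_rpow_const _ _ (Or.inl one_ne_zero)
  scale_one := Real.one_rpow _

lemma tendsto_log_mul_div_log {k : ℝ} (hk : 0 < k) :
    Tendsto (fun L => Real.log (k * L) / Real.log L) atTop (𝓝 1) := by
  have h1 : Tendsto (fun L => Real.log k / Real.log L + 1) atTop (𝓝 (0 + 1)) :=
    (Real.tendsto_log_atTop.const_div_atTop _).add tendsto_const_nhds
  rw [zero_add] at h1
  refine h1.congr' ?_
  filter_upwards [eventually_gt_atTop 1] with L hL
  have := Real.log_pos hL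
  rw [Real.log_mul hk.ne' (by linarith)]
  field_simp

/-- One step multiplies `L` by `1 + c`. -/
lemma isHeightScale_log {b : ℝ} (hb : 0 < b) :
    IsHeightScale (fun L => Real.log L / Real.log (1 + b)) b 1
      (fun c => Real.log (1 + c) / Real.log (1 + b)) (fun _ => 1) where
  strictMonoOn := by
    refine ⟨1, fun x hx y _ hxy => ?_⟩
    exact div_lt_div_of_pos_right (Real.log_lt_log (by linarith [Set.mem_Ici.1 hx]) hxy)
      (Real.log_pos (by linarith))
  tendsto := Real.tendsto_log_atTop.atTop_div_const (Real.log_pos (by linarith))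
  increment := by
    intro c hc
    refine tendsto_const_nhds.congr' ?_
    filter_upwards [eventually_gt_atTop 0] with L hL
    rw [Real.rpow_one, show L + c * L = (1 + c) * L by ring,
      Real.log_mul (by positivity) hL.ne']
    ring
  scale := by
    intro k hk
    refine (tendsto_log_mul_div_log hk).congr fun L => ?_
    rw [div_div_div_cancel_right₀ (Real.log_pos (by linarith)).ne']
  continuousAt_increment := by
    have : ContinuousAt (fun c : ℝ => Real.log (1 + c)) b :=
      ContinuousAt.log (by fun_prop) (by linarith)
    exact this.div_const _
  increment_eq := div_self (Real.log_pos (by linarith)).ne'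
  continuousAt_scale := continuousAt_const
  scale_one := rfl

/-- Here `c * L ^ β` dominates, so `log L` is asymptotically multiplied by `β`, whatever `c` is.
This insensitivity to constants permits a large `κ` in the lower bound. -/
lemma isHeightScale_log_log {b β : ℝ} (hβ : 1 < β) :
    IsHeightScale (fun L => Real.log (Real.log L) / Real.log β) b β
      (fun _ => 1) (fun _ => 1) where
  strictMonoOn := by
    refine ⟨Real.exp 1, fun x hx y _ hxy => ?_⟩
    have hx0 : 0 < x := (Real.exp_pos 1).trans_le hx
    have hx1 : 1 ≤ Real.log x := (Real.le_log_iff_exp_le hx0).2 hx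
    exact div_lt_div_of_pos_right (Real.log_lt_log (by linarith) (Real.log_lt_log hx0 hxy))
      (Real.log_pos hβ)
  tendsto := (Real.tendsto_log_atTop.comp Real.tendsto_log_atTop).atTop_div_const (Real.log_pos hβ)
  increment := by
    intro c hc
    have hlogβ := Real.log_pos hβ
    have h1 : Tendsto (fun L : ℝ => c + L ^ (-(β - 1))) atTop (𝓝 (c + 0)) :=
      tendsto_const_nhds.add (tendsto_rpow_neg_atTop (by linarith))
    rw [add_zero] at h1
    have h2 : Tendsto (fun L : ℝ => β + Real.log (c + L ^ (-(β - 1))) / Real.log L) atTop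
        (𝓝 (β + 0)) :=
      tendsto_const_nhds.add (((Real.continuousAt_log hc.ne').tendsto.comp h1).div_atTop
        Real.tendsto_log_atTop)
    rw [add_zero] at h2
    have h3 := ((Real.continuousAt_log (show β ≠ 0 by linarith)).tendsto.comp h2).div_const
      (Real.log β)
    rw [div_self hlogβ.ne'] at h3
    refine h3.congr' ?_
    filter_upwards [eventually_gt_atTop 1] with L hL
    have hL0 : 0 < L := by linarith
    have hlog := Real.log_pos hL
    have hLb := Real.rpow_pos_of_pos hL0 β
    have hLn := Real.rpow_pos_of_pos hL0 (-(β - 1))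
    have h4 : L + c * L ^ β = L ^ β * (c + L ^ (-(β - 1))) := by
      rw [mul_add, ← Real.rpow_add hL0, show β + -(β - 1) = 1 by ring, Real.rpow_one]
      ring
    have h5 : β + Real.log (c + L ^ (-(β - 1))) / Real.log L
        = Real.log (L + c * L ^ β) / Real.log L := by
      rw [h4, Real.log_mul hLb.ne' (by positivity), Real.log_rpow hL0]
      field_simp
    have h6 : 0 < Real.log (L + c * L ^ β) := Real.log_pos (by nlinarith)
    simp only [Function.comp]
    rw [h5, Real.log_div h6.ne' hlog.ne', sub_div]
  scale := by
    intro k hk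
    have hlogβ := Real.log_pos hβ
    have hll : Tendsto (fun L => Real.log (Real.log L)) atTop atTop :=
      Real.tendsto_log_atTop.comp Real.tendsto_log_atTop
    have h1 := (((Real.continuousAt_log one_ne_zero).tendsto.comp
      (tendsto_log_mul_div_log hk)).div_atTop hll).add_const 1
    rw [zero_add] at h1
    refine h1.congr' ?_
    have hkL : Tendsto (fun L : ℝ => k * L) atTop atTop := tendsto_id.const_mul_atTop hk
    filter_upwards [eventually_gt_atTop 1, hkL.eventually_gt_atTop 1, hll.eventually_gt_atTop 0]
      with L hL hL2 hL3
    simp only [Function.comp]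
    rw [Real.log_div (Real.log_pos hL2).ne' (Real.log_pos hL).ne',
      div_div_div_cancel_right₀ hlogβ.ne']
    field_simp
    ring
  continuousAt_increment := continuousAt_const
  increment_eq := rfl
  continuousAt_scale := continuousAt_const
  scale_one := rfl

end Scales

lemma isEquivalent_of_forall_bounds {f F : ℕ → ℝ} (hF : Tendsto F atTop atTop)
    (h : ∀ k : ℕ, ∃ C : ℝ, ∀ᶠ n in atTop,
      (1 - 1 / (k + 1 : ℝ)) * F n - C ≤ f n ∧ f n ≤ C + (1 + 1 / (k + 1 : ℝ)) * F n) :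
    f ~[atTop] F := by
  refine isLittleO_iff.2 fun η hη => ?_
  obtain ⟨k, hk⟩ := exists_nat_one_div_lt (half_pos hη)
  obtain ⟨C, hC⟩ := h k
  filter_upwards [hC, hF.eventually_ge_atTop (2 / η * C), hF.eventually_ge_atTop 0]
    with n hn h1 h2
  have h3 : C ≤ η / 2 * F n := by
    have := mul_le_mul_of_nonneg_left h1 (show 0 ≤ η / 2 by positivity)
    rwa [← mul_assoc, show η / 2 * (2 / η) = 1 by field_simp, one_mul] at this
  have h4 : 1 / (k + 1 : ℝ) * F n ≤ η / 2 * F n := mul_le_mul_of_nonneg_right hk.le h2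
  rw [Pi.sub_apply, Real.norm_eq_abs, Real.norm_of_nonneg h2, abs_le]
  constructor <;> linarith [hn.1, hn.2]

/-! ### Asymptotic equivalence and the main theorem. -/

section Main

variable {Ω : Type*} [MeasurableSpace Ω] {μ : Measure Ω} [IsProbabilityMeasure μ]
  {w : ℕ → ℝ} {T : Ω → GrowingTree} {aInf α β : ℝ} {Ψ ρ σ : ℝ → ℝ}

lemma exists_height_le (hT : IsWRT μ w T) (hw : ∀ n, 1 ≤ n → 0 ≤ w n) (hw1 : 0 < w 1)
    (ha : Tendsto (a w) atTop (𝓝 aInf)) (hα : 1 < α) (hβ : 0 < β)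
    (htail : ∀ η > 0, ∀ᶠ n : ℕ in atTop, aInf - a w n ≤ Real.exp (-(α - 1 - η) * Real.log n ^ β))
    (hΨ : IsHeightScale Ψ (α - 1) β ρ σ) {η : ℝ} (hη : 0 < η) :
    ∀ᵐ ω ∂μ, ∃ C : ℝ, ∀ᶠ n : ℕ in atTop,
      ((T ω).height n : ℝ) ≤ C + (1 + η) * Ψ (Real.log n) := by
  have hα' : 0 < α - 1 := by linarith
  obtain ⟨x₀, hx₀⟩ := hΨ.strictMonoOn
  obtain ⟨δ, hδ0, hδ1, hδη⟩ : ∃ δ : ℝ, 0 < δ ∧ δ < 1 ∧ (1 + δ) / (1 - δ) < 1 + η := by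
    have h1 : Tendsto (fun δ : ℝ => (1 + δ) / (1 - δ)) (𝓝[>] 0) (𝓝 ((1 + 0) / (1 - 0))) := by
      refine Tendsto.mono_left (ContinuousAt.tendsto ?_) nhdsWithin_le_nhds
      exact ContinuousAt.div (by fun_prop) (by fun_prop) (by norm_num)
    obtain ⟨δ, h2, h3⟩ := ((h1.eventually_lt_const (show (1 + 0) / (1 - 0) < 1 + η by linarith)).and
      (Ioo_mem_nhdsGT (zero_lt_one (α := ℝ)))).exists
    exact ⟨δ, h3.1, h3.2, h2⟩
  obtain ⟨ε, hε0, hε1, hερ, hεσ⟩ : ∃ ε : ℝ, 0 < ε ∧ ε < 1 ∧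
      1 - δ < ρ ((1 - ε) * (α - 1) * (1 - ε) ^ β) ∧ σ (1 / (1 - ε)) < 1 + δ := by
    have hc : ContinuousAt (fun ε : ℝ => (1 - ε) * (α - 1) * (1 - ε) ^ β) 0 := by
      have : ContinuousAt (fun ε : ℝ => (1 - ε) ^ β) 0 :=
        ContinuousAt.rpow_const (by fun_prop) (Or.inl (by norm_num))
      exact ContinuousAt.mul (by fun_prop) this
    have hk : ContinuousAt (fun ε : ℝ => 1 / (1 - ε)) 0 :=
      ContinuousAt.div (by fun_prop) (by fun_prop) (by norm_num)
    have h1 := hΨ.continuousAt_increment.tendsto.comp (hc.tendsto.trans (by simp))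
    have h2 := hΨ.continuousAt_scale.tendsto.comp (hk.tendsto.trans (by simp))
    rw [hΨ.increment_eq] at h1
    rw [hΨ.scale_one] at h2
    obtain ⟨ε, ⟨h3, h4⟩, h5⟩ := ((((h1.mono_left nhdsWithin_le_nhds).eventually_const_lt
      (show 1 - δ < 1 by linarith)).and ((h2.mono_left nhdsWithin_le_nhds).eventually_lt_const
      (show 1 < 1 + δ by linarith))).and (Ioo_mem_nhdsGT (zero_lt_one (α := ℝ)))).exists
    exact ⟨ε, h5.1, h5.2, h3, h4⟩
  have hε' : 0 < 1 - ε := by linarith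
  have hinc : ∀ᶠ L in atTop, Ψ L + (1 - δ) ≤ Ψ (L + (1 - ε) * (α - 1) * ((1 - ε) * L) ^ β) := by
    filter_upwards [(hΨ.increment ((1 - ε) * (α - 1) * (1 - ε) ^ β)
      (by positivity)).eventually_const_lt hερ, eventually_ge_atTop 0] with L hL hL0
    rw [Real.mul_rpow hε'.le hL0, ← mul_assoc]
    linarith
  have hscale : ∀ᶠ L in atTop, Ψ (L / (1 - ε)) ≤ (1 + δ) * Ψ L := by
    filter_upwards [(hΨ.scale (1 / (1 - ε)) (by positivity)).eventually_lt_const hεσ,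
      hΨ.tendsto.eventually_gt_atTop 0] with L hL hL0
    rw [div_lt_iff₀ hL0, one_div_mul_eq_div] at hL
    exact hL.le
  filter_upwards [ae_height_le hT hw hw1 ha hα hβ htail hx₀ hΨ.tendsto hδ1 hε0 hε1 hinc]
    with ω ⟨C, hC⟩
  refine ⟨C, ?_⟩
  filter_upwards [hC, tendsto_log_natCast.eventually hscale,
    (hΨ.tendsto.comp tendsto_log_natCast).eventually_ge_atTop 0] with n h1 h2 h3
  have hδ' : 0 < 1 - δ := by linarith
  calc ((T ω).height n : ℝ) ≤ C + Ψ (Real.log n / (1 - ε)) / (1 - δ) := h1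
    _ ≤ C + (1 + δ) * Ψ (Real.log n) / (1 - δ) := by gcongr
    _ = C + (1 + δ) / (1 - δ) * Ψ (Real.log n) := by ring
    _ ≤ _ := add_le_add_right (mul_le_mul_of_nonneg_right hδη.le h3) _

/-- The second moment hypothesis is quantified so as to cover both uses: `κ` close to one when the
constants matter, and a fixed large `κ` when `ρ` and `σ` are constant. -/
lemma exists_le_height (hT : IsWRT μ w T) (hw : ∀ n, 1 ≤ n → 0 ≤ w n) (hw1 : 0 < w 1)
    (ha : Tendsto (a w) atTop (𝓝 aInf)) (hα : 1 < α) (hβ : 0 < β)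
    (htail : ∀ η > 0, ∀ᶠ n : ℕ in atTop, Real.exp (-(α - 1 + η) * Real.log n ^ β) ≤ aInf - a w n)
    (hmass : ∀ c > 0, ∀ᶠ n : ℕ in atTop, ∀ m : ℕ, Real.log n + c * Real.log n ^ β ≤ Real.log m →
      (aInf - a w n) / Real.log n ≤ a w m - a w n)
    (hΨ : IsHeightScale Ψ (α - 1) β ρ σ)
    (hsq : ∀ δ > 0, ∃ ε > 0, ∃ κ ≥ 1, ∃ η > 0,
      (∀ᶠ n : ℕ in atTop, sqTail w n ≤ (n : ℝ) ^ (-(1 / κ + η)) * (aInf - a w n) ^ 2) ∧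
      ρ ((1 + ε) * (α - 1) * κ ^ β) < 1 + δ ∧ 1 - δ < σ (1 / κ)) {η : ℝ} (hη : 0 < η) :
    ∀ᵐ ω ∂μ, ∃ C : ℝ, ∀ᶠ n : ℕ in atTop,
      (1 - η) * Ψ (Real.log n) - C ≤ ((T ω).height n : ℝ) := by
  have hα' : 0 < α - 1 := by linarith
  obtain ⟨x₀, hx₀⟩ := hΨ.strictMonoOn
  obtain ⟨δ, hδ0, hδη⟩ : ∃ δ : ℝ, 0 < δ ∧ 1 - η < (1 - δ) / (1 + δ) := by
    have h1 : Tendsto (fun δ : ℝ => (1 - δ) / (1 + δ)) (𝓝[>] 0) (𝓝 ((1 - 0) / (1 + 0))) := by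
      refine Tendsto.mono_left (ContinuousAt.tendsto ?_) nhdsWithin_le_nhds
      exact ContinuousAt.div (by fun_prop) (by fun_prop) (by norm_num)
    obtain ⟨δ, h2, h3⟩ := ((h1.eventually_const_lt (show 1 - η < (1 - 0) / (1 + 0) by linarith)).and
      self_mem_nhdsWithin).exists
    exact ⟨δ, h3, h2⟩
  obtain ⟨ε, hε0, κ, hκ, η', hη', hsq', hρ, hσ⟩ := hsq δ hδ0
  have hκ0 : 0 < κ := by linarith
  have hinc : ∀ᶠ L in atTop, Ψ (L + (1 + ε) * (α - 1) * (κ * L) ^ β) ≤ Ψ L + (1 + δ) := by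
    filter_upwards [(hΨ.increment ((1 + ε) * (α - 1) * κ ^ β)
      (by positivity)).eventually_lt_const hρ, eventually_ge_atTop 0] with L hL hL0
    rw [Real.mul_rpow hκ0.le hL0, ← mul_assoc]
    linarith
  have hscale : ∀ᶠ L in atTop, (1 - δ) * Ψ L ≤ Ψ (L / κ) := by
    filter_upwards [(hΨ.scale (1 / κ) (by positivity)).eventually_const_lt hσ,
      hΨ.tendsto.eventually_gt_atTop 0] with L hL hL0
    rw [lt_div_iff₀ hL0, one_div_mul_eq_div] at hL
    exact hL.le
  filter_upwards [ae_le_height hT hw hw1 ha hα hβ htail hmass hκ hη' hsq' hx₀ hΨ.tendsto hδ0 hε0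
    hinc] with ω ⟨C, hC⟩
  refine ⟨C, ?_⟩
  filter_upwards [hC, tendsto_log_natCast.eventually hscale,
    (hΨ.tendsto.comp tendsto_log_natCast).eventually_ge_atTop 0] with n h1 h2 h3
  have hδ' : 0 < 1 + δ := by linarith
  calc (1 - η) * Ψ (Real.log n) - C ≤ (1 - δ) / (1 + δ) * Ψ (Real.log n) - C :=
        sub_le_sub_right (mul_le_mul_of_nonneg_right hδη.le h3) _
    _ = (1 - δ) * Ψ (Real.log n) / (1 + δ) - C := by ring
    _ ≤ Ψ (Real.log n / κ) / (1 + δ) - C := by gcongr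
    _ ≤ _ := h1

theorem ae_height_isEquivalent (hT : IsWRT μ w T) (hw : ∀ n, 1 ≤ n → 0 ≤ w n) (hw1 : 0 < w 1)
    (ha : Tendsto (a w) atTop (𝓝 aInf)) (hα : 1 < α) (hβ : 0 < β)
    (htail : ∀ η > 0, ∀ᶠ n : ℕ in atTop, Real.exp (-(α - 1 + η) * Real.log n ^ β) ≤ aInf - a w n ∧
      aInf - a w n ≤ Real.exp (-(α - 1 - η) * Real.log n ^ β))
    (hmass : ∀ c > 0, ∀ᶠ n : ℕ in atTop, ∀ m : ℕ, Real.log n + c * Real.log n ^ β ≤ Real.log m →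
      (aInf - a w n) / Real.log n ≤ a w m - a w n)
    (hΨ : IsHeightScale Ψ (α - 1) β ρ σ)
    (hsq : ∀ δ > 0, ∃ ε > 0, ∃ κ ≥ 1, ∃ η > 0,
      (∀ᶠ n : ℕ in atTop, sqTail w n ≤ (n : ℝ) ^ (-(1 / κ + η)) * (aInf - a w n) ^ 2) ∧
      ρ ((1 + ε) * (α - 1) * κ ^ β) < 1 + δ ∧ 1 - δ < σ (1 / κ)) :
    ∀ᵐ ω ∂μ, (fun n : ℕ => ((T ω).height n : ℝ)) ~[atTop] fun n : ℕ => Ψ (Real.log n) := by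
  have hup : ∀ k : ℕ, ∀ᵐ ω ∂μ, ∃ C : ℝ, ∀ᶠ n : ℕ in atTop,
      ((T ω).height n : ℝ) ≤ C + (1 + 1 / (k + 1 : ℝ)) * Ψ (Real.log n) := fun k =>
    exists_height_le hT hw hw1 ha hα hβ (fun η hη => (htail η hη).mono fun n h => h.2) hΨ
      (by positivity)
  have hlo : ∀ k : ℕ, ∀ᵐ ω ∂μ, ∃ C : ℝ, ∀ᶠ n : ℕ in atTop,
      (1 - 1 / (k + 1 : ℝ)) * Ψ (Real.log n) - C ≤ ((T ω).height n : ℝ) := fun k =>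
    exists_le_height hT hw hw1 ha hα hβ (fun η hη => (htail η hη).mono fun n h => h.1) hmass hΨ hsq
      (by positivity)
  -- Restricting to the precisions `1 / (k + 1)` leaves countably many null sets.
  filter_upwards [ae_all_iff.2 hup, ae_all_iff.2 hlo] with ω h1 h2
  refine isEquivalent_of_forall_bounds (hΨ.tendsto.comp tendsto_log_natCast) fun k => ?_
  obtain ⟨C₁, hC₁⟩ := h1 k
  obtain ⟨C₂, hC₂⟩ := h2 k
  refine ⟨max C₁ C₂, ?_⟩
  filter_upwards [hC₁, hC₂] with n h3 h4
  exact ⟨by linarith [le_max_right C₁ C₂], by linarith [le_max_left C₁ C₂]⟩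

/-- The form of the second moment condition that allows all `κ > 1`. -/
lemma exists_of_forall_one_lt (hΨ : IsHeightScale Ψ (α - 1) β ρ σ) {p : ℝ → ℝ → Prop}
    (hp : ∀ κ > 1, ∃ η > 0, p κ η) :
    ∀ δ > 0, ∃ ε > 0, ∃ κ ≥ 1, ∃ η > 0, p κ η ∧
      ρ ((1 + ε) * (α - 1) * κ ^ β) < 1 + δ ∧ 1 - δ < σ (1 / κ) := by
  intro δ hδ
  have hc : ContinuousAt (fun ε : ℝ => (1 + ε) * (α - 1) * (1 + ε) ^ β) 0 := by
    have : ContinuousAt (fun ε : ℝ => (1 + ε) ^ β) 0 :=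
      ContinuousAt.rpow_const (by fun_prop) (Or.inl (by norm_num))
    exact ContinuousAt.mul (by fun_prop) this
  have hk : ContinuousAt (fun ε : ℝ => 1 / (1 + ε)) 0 :=
    ContinuousAt.div (by fun_prop) (by fun_prop) (by norm_num)
  have h1 := hΨ.continuousAt_increment.tendsto.comp (hc.tendsto.trans (by simp))
  have h2 := hΨ.continuousAt_scale.tendsto.comp (hk.tendsto.trans (by simp))
  rw [hΨ.increment_eq] at h1
  rw [hΨ.scale_one] at h2
  obtain ⟨ε, ⟨h3, h4⟩, h5⟩ := ((((h1.mono_left nhdsWithin_le_nhds).eventually_lt_const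
    (show 1 < 1 + δ by linarith)).and ((h2.mono_left nhdsWithin_le_nhds).eventually_const_lt
    (show 1 - δ < 1 by linarith))).and (self_mem_nhdsWithin (a := (0 : ℝ)) (s := Set.Ioi 0))).exists
  have h5' : 0 < ε := h5
  obtain ⟨η, hη, hpη⟩ := hp (1 + ε) (by linarith)
  exact ⟨ε, h5', 1 + ε, by linarith, η, hη, hpη, h3, h4⟩

lemma eventually_const_mul_rpow_le {C s t : ℝ} (hst : s < t) :
    ∀ᶠ n : ℕ in atTop, C * (n : ℝ) ^ s ≤ (n : ℝ) ^ t := by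
  have h1 : Tendsto (fun n : ℕ => (n : ℝ) ^ (t - s)) atTop atTop :=
    (tendsto_rpow_atTop (by linarith)).comp tendsto_natCast_atTop_atTop
  filter_upwards [h1.eventually_ge_atTop C, eventually_ge_atTop 1] with n hn hn1
  have hn0 : (0 : ℝ) < n := by exact_mod_cast hn1
  have h2 := mul_le_mul_of_nonneg_right hn (Real.rpow_nonneg hn0.le s)
  rwa [← Real.rpow_add hn0, sub_add_cancel] at h2

/-- A polynomial bound for the tail of squares, compared with a polynomial lower bound for
`aInf - a n`. -/
lemma sqTail_le_of_isBigO {p e s : ℝ} (hO : sqTail w =O[atTop] fun n : ℕ => 1 / (n : ℝ) ^ p)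
    (hA : ∀ᶠ n : ℕ in atTop, (n : ℝ) ^ (-e) ≤ aInf - a w n) (hs : s < p - 2 * e) :
    ∀ᶠ n : ℕ in atTop, sqTail w n ≤ (n : ℝ) ^ (-s) * (aInf - a w n) ^ 2 := by
  obtain ⟨C, hC⟩ := hO.bound
  filter_upwards [hC, hA, eventually_ge_atTop 1,
    eventually_const_mul_rpow_le (C := C) (s := -p) (t := -s + (-e + -e)) (by linarith)]
    with n h1 h2 hn h3
  have hn0 : (0 : ℝ) < n := by exact_mod_cast hn
  have h4 : sqTail w n ≤ C * (n : ℝ) ^ (-p) := by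
    refine (le_abs_self _).trans (h1.trans (le_of_eq ?_))
    rw [Real.norm_of_nonneg (by positivity), Real.rpow_neg hn0.le, one_div]
  refine h4.trans (h3.trans ?_)
  rw [Real.rpow_add hn0, Real.rpow_add hn0, ← sq]
  gcongr

end Main

end WRT

theorem theorem1p2 {Ω : Type*} [MeasurableSpace Ω] (μ : Measure Ω) [IsProbabilityMeasure μ]
    (w : ℕ → ℝ) (hw : ∀ n, 1 ≤ n → 0 ≤ w n) (hw1 : 0 < w 1)
    (T : Ω → GrowingTree) (hT : WRT.IsWRT μ w T)
    (α β : ℝ) (hα : 1 < α) (hβ : 0 < β)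
    (J : ℝ → ℝ) (hJpos : ∀ x, 1 ≤ x → 0 < J x)
    (hJ2 : β < 1 / 2 → WRT.SmoothlySlowlyVarying 2 J)
    (hJ0 : 1 / 2 ≤ β → WRT.SlowlyVarying J)
    (ha : WRT.QuicklyConverging w α β J) :
    (β < 1 →
      WRT.sqTail w =O[atTop] (fun n : ℕ => 1 / (n : ℝ)) →
      ∀ᵐ ω ∂μ, (fun n : ℕ => ((T ω).height n : ℝ)) ~[atTop]
        fun n : ℕ => Real.log n ^ (1 - β) / ((α - 1) * (1 - β))) ∧
    (β = 1 →
      (∀ ε : ℝ, 0 < ε →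
        WRT.sqTail w =O[atTop] (fun n : ℕ => 1 / (n : ℝ) ^ (2 * α - 1 - ε))) →
      ∀ᵐ ω ∂μ, (fun n : ℕ => ((T ω).height n : ℝ)) ~[atTop]
        fun n : ℕ => Real.log (Real.log n) / Real.log α) ∧
    (1 < β →
      (∃ ε : ℝ, 0 < ε ∧
        WRT.sqTail w =O[atTop] (fun n : ℕ => 1 / (n : ℝ) ^ ε *
          Real.exp (-2 * (α - 1) * Real.log n ^ β) * J (Real.exp (Real.log n ^ β)) ^ 2)) →
      ∀ᵐ ω ∂μ, (fun n : ℕ => ((T ω).height n : ℝ)) ~[atTop]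
        fun n : ℕ => Real.log (Real.log (Real.log n)) / Real.log β) := by
  have hα' : 0 < α - 1 := by linarith
  obtain ⟨aInf, haInf, r, hr, hA⟩ := ha
  have htail := fun (η : ℝ) (hη : η > 0) => WRT.tail_bounds hβ hJpos hJ2 hJ0 hr hA hη
  have hmass := fun (c : ℝ) (hc : c > 0) => WRT.window_mass hα hβ hJpos hJ2 hJ0 hr hA hc
  refine ⟨fun hβ1 hO => ?_, fun hβ1 hO => ?_, fun hβ1 hO => ?_⟩
  · have hΨ := WRT.isHeightScale_of_lt_one hα' hβ1
    refine WRT.ae_height_isEquivalent hT hw hw1 haInf hα hβ htail hmass hΨ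
      (WRT.exists_of_forall_one_lt hΨ fun κ hκ => ?_)
    have hκ' : 1 / κ < 1 := by rw [div_lt_one (by linarith)]; exact hκ
    have hd : 0 < (1 - 1 / κ) / 4 := by linarith
    -- For `β < 1` the tail of `a` decays more slowly than any power of `n`, so `e = (1 - 1 / κ) /
    -- 4` is allowed; then `1 / κ + η < 1 - 2 * e` for `η = e`.
    refine ⟨(1 - 1 / κ) / 4, hd, ?_⟩
    have hO' : WRT.sqTail w =O[atTop] fun n : ℕ => 1 / (n : ℝ) ^ (1 : ℝ) := by
      simpa only [Real.rpow_one] using hO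
    refine WRT.sqTail_le_of_isBigO hO' (e := (1 - 1 / κ) / 4) ?_ (by linarith)
    have hlim : Tendsto (fun n : ℕ => Real.log n ^ (1 - β)) atTop atTop :=
      (tendsto_rpow_atTop (by linarith)).comp WRT.tendsto_log_natCast
    filter_upwards [htail 1 one_pos, hlim.eventually_ge_atTop (α / ((1 - 1 / κ) / 4)),
      eventually_ge_atTop 1, WRT.tendsto_log_natCast.eventually_ge_atTop 1] with n h1 h2 hn h3
    refine le_trans ?_ h1.1
    have hn0 : (0 : ℝ) < n := by exact_mod_cast hn
    have hl0 : 0 < Real.log n := by linarith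
    rw [Real.rpow_def_of_pos hn0]
    refine Real.exp_le_exp.2 ?_
    rw [div_le_iff₀ hd] at h2
    have h4 := mul_le_mul_of_nonneg_right h2 (Real.rpow_nonneg hl0.le β)
    have h5 : Real.log n ^ (1 - β) * Real.log n ^ β = Real.log n := by
      rw [← Real.rpow_add hl0, sub_add_cancel, Real.rpow_one]
    have h6 : Real.log n ^ (1 - β) * ((1 - 1 / κ) / 4) * Real.log n ^ β
        = Real.log n * ((1 - 1 / κ) / 4) := by
      rw [mul_right_comm, h5]
    linarith
  · subst hβ1
    have hΨ := WRT.isHeightScale_log hα'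
    rw [add_sub_cancel] at hΨ
    refine WRT.ae_height_isEquivalent hT hw hw1 haInf hα hβ htail hmass hΨ
      (WRT.exists_of_forall_one_lt hΨ fun κ hκ => ?_)
    have hκ' : 1 / κ < 1 := by rw [div_lt_one (by linarith)]; exact hκ
    have hd : 0 < (1 - 1 / κ) / 8 := by linarith
    -- With `D = 1 - 1 / κ`, the requirement `s < p - 2 * e` reads `1 - 7 * D / 8 < 1 - 3 * D / 8`.
    refine ⟨(1 - 1 / κ) / 8, hd, ?_⟩
    refine WRT.sqTail_le_of_isBigO (hO _ hd) (e := α - 1 + (1 - 1 / κ) / 8) ?_ (by linarith)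
    filter_upwards [htail _ hd, eventually_ge_atTop 1] with n h1 hn
    refine le_trans (le_of_eq ?_) h1.1
    have hn0 : (0 : ℝ) < n := by exact_mod_cast hn
    rw [Real.rpow_def_of_pos hn0, Real.rpow_one]
    ring_nf
  · have hΨ := WRT.isHeightScale_log_log (b := α - 1) hβ1
    refine WRT.ae_height_isEquivalent hT hw hw1 haInf hα hβ htail hmass hΨ fun δ hδ => ?_
    obtain ⟨ε, hε, hO⟩ := hO
    obtain ⟨C, hC⟩ := hO.bound
    -- `κ` is chosen so that `1 / κ + ε / 4 ≤ 3 * ε / 4 < ε`; the conditions on `ρ` and `σ` are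
    -- trivial because both are constantly one.
    refine ⟨1, one_pos, max 1 (2 / ε), le_max_left _ _, ε / 4, by positivity, ?_, by linarith,
      by linarith⟩
    have hκ : 1 / max 1 (2 / ε) ≤ ε / 2 := by
      rw [div_le_iff₀ (by positivity)]
      have := mul_le_mul_of_nonneg_left (le_max_right 1 (2 / ε)) (show 0 ≤ ε / 2 by positivity)
      rwa [show ε / 2 * (2 / ε) = 1 by field_simp] at this
    filter_upwards [hC, WRT.eventually_abs_error_le hr (show (0 : ℝ) < 1 / 2 by norm_num),
      eventually_ge_atTop 1, WRT.tendsto_log_natCast.eventually_ge_atTop 1,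
      WRT.eventually_const_mul_rpow_le (C := 4 * C) (s := -ε)
        (t := -(1 / max 1 (2 / ε) + ε / 4)) (by linarith)] with n h1 h2 hn h3 h4
    have hn0 : (0 : ℝ) < n := by exact_mod_cast hn
    have h5 : |r n| ≤ 1 / 2 := h2.trans (by
      have := WRT.rpow_min_zero_le_one h3 (2 * β - 1); linarith)
    have hmain : 0 < WRT.mainTerm α β J n := by
      rw [WRT.mainTerm_eq hJpos hn]; positivity
    have h6 : WRT.mainTerm α β J n / 2 ≤ aInf - WRT.a w n := by
      rw [hA n hn]
      nlinarith [(abs_le.1 h5).1]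
    have h7 : WRT.sqTail w n ≤ C * ((n : ℝ) ^ (-ε) * WRT.mainTerm α β J n ^ 2) := by
      refine (le_abs_self _).trans (h1.trans (le_of_eq ?_))
      rw [Real.norm_of_nonneg (by positivity), Real.rpow_neg hn0.le, WRT.mainTerm, mul_pow,
        ← Real.exp_nat_mul, one_div]
      push_cast
      ring_nf
    calc WRT.sqTail w n ≤ C * ((n : ℝ) ^ (-ε) * WRT.mainTerm α β J n ^ 2) := h7
      _ = 4 * C * (n : ℝ) ^ (-ε) * (WRT.mainTerm α β J n / 2) ^ 2 := by ring
      _ ≤ (n : ℝ) ^ (-(1 / max 1 (2 / ε) + ε / 4)) * (WRT.mainTerm α β J n / 2) ^ 2 := by gcongr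
      _ ≤ (n : ℝ) ^ (-(1 / max 1 (2 / ε) + ε / 4)) * (aInf - WRT.a w n) ^ 2 := by gcongr
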